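/- Let $d\ge 1$, let $n=d+3$ (so that the codimension is $k=n-d-1=2$), let $\mathcal A=\{a_1,\dots,a_n\}\subset\mathbb R^d$ consist of $n$ distinct points, let $A\in\mathbb R^{(d+1)\times n}$ be the matrix with columns $(1,a_1),\dots,(1,a_n)$, and let $C=(c_{ij})\in\mathbb R^{d\times n}$ have columns $C_1,\dots,C_n$. Write $n_{\mathcal A}(C)$ for the (possibly infinite) number of solutions $x\in\mathbb R_{>0}^d$ of the system $\sum_{j=1}^n c_{ij}x^{a_j}=0$, $i=1,\dots,d$. A Gale dual of a matrix $M$ is a matrix whose columns form a basis of $\ker M$, and a matrix with at least as many columns as rows is called uniform if none of its maximal minors vanishes. For a Gale dual $D=(d_{ij})\in\mathbb R^{n\times 3}$ of $C$, with columns numbered $0,1,2$ and rows $P_1,\dots,P_n\in\mathbb R^{3}$, put $$\Delta_P=\{y\in\mathbb R^{3} : y_0=1,\ \langle P_i,y\rangle>0 \text{ for } i=1,\dots,n\}.$$ Let $I_C\subset\{1,\dots,n\}$ be the set of indices of the minimal set of generators of the polyhedral cone generated by $P_1,\dots,P_n$, and for $L\subset I_C$ let $F_L=\{y\in\overline{\Delta_P}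 : \langle P_i,y\rangle=0 \text{ for all } i\in L\}$. For $B=(b_{ij})\in\mathbb R^{n\times 2}$, let $B_L$ be the submatrix of the rows of $B$ with index in $L$. A matrix is called weakly mixed if each of its columns either is zero or contains both a positive and a negative entry. Consider the following conditions on $B$ and $D$. 1. For every nonempty $L\subset I_C$ with $F_L\neq\emptyset$, the matrix $B_L$ is not weakly mixed. 2. For every $i\in I_C$: $b_{ij}d_{ij}\ge 0$ for $j=1,2$; $b_{ij}d_{ij}>0$ for some $j\in\{1,2\}$; and for $j=1,2$, if $b_{ij}=0$ then $d_{ij}=0$. **Lemma.** Assume that $A$ and $C$ are uniform and that $\mathbf 0\in\mathbb R_{>0}C_1+\dots+\mathbb R_{>0}C_n$. Then there exists a Gale dual $B\in\mathbb R^{n\times 2}$ of $A$ such that for every Gale dual $D\in\mathbb R^{n\times 3}$ of $C$ for which $\Delta_P$ is nonempty and bounded and condition (2) is satisfied, condition (1) is satisfied, and thus $n_{\mathcal A}(C)>0$. -/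

import Mathlib

noncomputable section

namespace GaleDuality

/-- The matrix whose `i`-th column is `(1, a i)`. -/
def pointMatrix {d n : ℕ} (a : Fin n → Fin d → ℝ) : Matrix (Fin (d + 1)) (Fin n) ℝ :=
  Matrix.of fun r i => (Fin.cons (1 : ℝ) (a i) : Fin (d + 1) → ℝ) r

/-- No maximal minor of `M` (a matrix with at least as many columns as rows) vanishes. -/
def Uniform {r n : ℕ} (M : Matrix (Fin r) (Fin n) ℝ) : Prop :=
  ∀ s : Fin r → Fin n, Function.Injective s → (M.submatrix id s).det ≠ 0

/-- `N` is a Gale dual of `M`: its columns form a basis of the kernel of `M`. -/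
def IsGaleDual {r n m : ℕ} (M : Matrix (Fin r) (Fin n) ℝ) (N : Matrix (Fin n) (Fin m) ℝ) : Prop :=
  LinearIndependent ℝ N.col ∧ Submodule.span ℝ (Set.range N.col) = LinearMap.ker M.mulVecLin

/-- The open cone of all combinations of the columns of `C` with positive coefficients. -/
def openColumnCone {d n : ℕ} (C : Matrix (Fin d) (Fin n) ℝ) : Set (Fin d → ℝ) :=
  {v | ∃ t : Fin n → ℝ, (∀ i, 0 < t i) ∧ v = ∑ i, t i • C.col i}

/-- The monomial `x ^ a` with real exponents. -/
def monomial {d : ℕ} (x a : Fin d → ℝ) : ℝ := ∏ l, x l ^ a l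

/-- The positive solutions of the system `∑ j, C i j * x ^ (a j) = 0`, `i = 1, …, d`. -/
def positiveSolutions {d n : ℕ} (a : Fin n → Fin d → ℝ) (C : Matrix (Fin d) (Fin n) ℝ) :
    Set (Fin d → ℝ) :=
  {x | (∀ l, 0 < x l) ∧ ∀ i, ∑ j, C i j * monomial x (a j) = 0}

/-- The (possibly infinite) number of positive solutions of the system. -/
def numPositiveSolutions {d n : ℕ} (a : Fin n → Fin d → ℝ) (C : Matrix (Fin d) (Fin n) ℝ) : ℕ∞ :=
  (positiveSolutions a C).encard

/-- `Δ_P`: the points `y` with `y 0 = 1` having positive scalar product with every row of `D`. -/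
def delta {n k : ℕ} (D : Matrix (Fin n) (Fin (k + 1)) ℝ) : Set (Fin (k + 1) → ℝ) :=
  {y | (∀ i, 0 < D.row i ⬝ᵥ y) ∧ y 0 = 1}

/-- The closed cone generated by the rows of `D` with index in `I`. -/
def closedRowCone {n m : ℕ} (D : Matrix (Fin n) (Fin m) ℝ) (I : Set (Fin n)) : Set (Fin m → ℝ) :=
  {v | ∃ t : Fin n → ℝ, (∀ i, 0 ≤ t i) ∧ (∀ i, i ∉ I → t i = 0) ∧ v = ∑ i, t i • D.row i}

/-- `I` indexes a minimal set of generators of the polyhedral cone generated by all rows of `D`. -/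
def IsMinimalGenerating {n m : ℕ} (D : Matrix (Fin n) (Fin m) ℝ) (I : Set (Fin n)) : Prop :=
  Minimal (fun J : Set (Fin n) => closedRowCone D J = closedRowCone D Set.univ) I

/-- `F_L`: the set of points of the closure of `Δ_P` at which the scalar products with all the rows
of `D` with index in `L` vanish, i.e. the intersection of the facets `F_i`, `i ∈ L`. -/
def face {n k : ℕ} (D : Matrix (Fin n) (Fin (k + 1)) ℝ) (L : Set (Fin n)) :
    Set (Fin (k + 1) → ℝ) :=
  {y | y ∈ closure (delta D) ∧ ∀ i ∈ L, D.row i ⬝ᵥ y = 0}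

/-- The nonempty index sets `L ⊆ I` for which `F_L` is a (nonempty, proper) face of `Δ_P`. An
intersection of facets of a polytope is a face as soon as it is nonempty. -/
def faceIndexSets {n k : ℕ} (D : Matrix (Fin n) (Fin (k + 1)) ℝ) (I : Set (Fin n)) :
    Set (Set (Fin n)) :=
  {L | L ⊆ I ∧ L.Nonempty ∧ (face D L).Nonempty}

/-- Every column is zero, or contains both a positive and a negative entry. -/
def WeaklyMixed {ι κ : Type*} (M : Matrix ι κ ℝ) : Prop :=
  ∀ j, (∀ i, M i j = 0) ∨ ((∃ i, 0 < M i j) ∧ ∃ i, M i j < 0)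

/-- For every `L ∈ 𝓕(Δ_P)`, the submatrix `B_L` of rows of `B` with index in `L` is not weakly
mixed. The set `I` stands for `I_C`. -/
def ConditionOne {n k : ℕ} (B : Matrix (Fin n) (Fin k) ℝ) (D : Matrix (Fin n) (Fin (k + 1)) ℝ)
    (I : Set (Fin n)) : Prop :=
  ∀ L ∈ faceIndexSets D I, ¬ WeaklyMixed (B.submatrix (Subtype.val : L → Fin n) id)

/-- The sign conditions on the rows of `B` and `D` with index in `I = I_C`. The columns of `D` are
numbered from `0`, so that the `j`-th column of `B` is paired with the column `j.succ` of `D`. -/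
def ConditionTwo {n k : ℕ} (B : Matrix (Fin n) (Fin k) ℝ) (D : Matrix (Fin n) (Fin (k + 1)) ℝ)
    (I : Set (Fin n)) : Prop :=
  ∀ i ∈ I, (∀ j, 0 ≤ B i j * D i j.succ) ∧ (∃ j, 0 < B i j * D i j.succ) ∧
    ∀ j, B i j = 0 → D i j.succ = 0

end GaleDuality

end

/-! Uniqueness of minimal generating sets here, and their invariance under change of Gale dual, let
`B` be chosen before `D`. `exists_empty_double_wedge` supplies coordinates in which one row of `B`
indexed by `I` lies on the positive first axis, another on the negative second axis, and no row
indexed by `I` is in the open first or third quadrant.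

Suppose condition (2) holds and some `B_L` is weakly mixed. By uniformity only two edges meet at the
corresponding vertex, and their rows of `B` have signs (+,-) and (-,+). By condition (2) their inner
normals lie in the closed fourth and second quadrants, so the normal cone contains the first or the
third quadrant, according to orientation, and hence the normal of one of the two axis rows. This is
a third edge normal in the cone of a vertex, which is impossible (`false_of_normal_mem`). This gives
condition (1).

For the solution, consider the field `∑ -log ⟨P_i, y⟩ B_i` on `Δ_P`. Conditions (1) and (2) give at
each boundary point a vector `u` in the normal cone that pairs positively with the active rows of
`B` (`exists_normal_pos`), so near that point the logarithms make the field pair positively with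
`u`. A winding-number argument (`Complex.exists_eq_zero_of_frontier`) yields a zero, and
`positiveSolutions_nonempty` exponentiates it to a positive solution of the system. -/

/-! ### Zeros of planar vector fields -/

/-- A continuous self-map of the plane that is minus the identity far from the origin has a zero. -/
theorem Complex.exists_eq_zero_of_eq_neg_of_le_norm {g : ℂ → ℂ} (hg : Continuous g) {R : ℝ}
    (hR : 0 < R) (h : ∀ z : ℂ, R ≤ ‖z‖ → g z = -z) : ∃ z, g z = 0 := by
  by_contra! hne
  -- The plane is simply connected, so the direction of `g` has a continuous argument `F`.
  let G : C(ℂ, Circle) := ⟨fun z => ⟨g z / ‖g z‖, by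
    simp [Submonoid.unitSphere, hne z]⟩, by
      refine Continuous.subtype_mk ?_ _
      exact hg.div (by fun_prop) fun z => by simpa using hne z⟩
  obtain ⟨e₀, he₀⟩ : ∃ e₀, Circle.exp e₀ = G 0 := ⟨_, Circle.exp_arg _⟩
  obtain ⟨F, ⟨-, hF⟩, -⟩ := Circle.isCoveringMap_exp.existsUnique_continuousMap_lifts G
    (a₀ := (0 : ℂ)) (e₀ := e₀) he₀
  have hGR : ∀ θ : ℝ, G (R * Circle.exp θ) = Circle.exp (θ + Real.pi) := by
    intro θ
    ext
    have h1 : ‖(R * Circle.exp θ : ℂ)‖ = R := by simp [abs_of_pos hR]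
    have h2 := h (R * Circle.exp θ) h1.ge
    have hRC : (R : ℂ) ≠ 0 := by exact_mod_cast hR.ne'
    change g _ / (‖g _‖ : ℂ) = _
    rw [h2, norm_neg, h1, Circle.exp_add, Circle.coe_mul, Circle.coe_exp Real.pi,
      Complex.exp_pi_mul_I]
    field_simp
  have hconst : ∀ θ : ℝ, Circle.exp (F (R * Circle.exp θ) - θ) = Circle.exp Real.pi := by
    intro θ
    have := congrFun hF (R * Circle.exp θ)
    simp only [Function.comp_apply] at this
    rw [Circle.exp_sub, this, hGR, Circle.exp_add, mul_comm, mul_div_assoc, div_self', mul_one]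
  let k : C(ℝ, ℝ) := ⟨fun θ => F (R * Circle.exp θ) - θ, by fun_prop⟩
  have hk : (k : ℝ → ℝ) = fun _ => k 0 := by
    refine Circle.isCoveringMap_exp.eq_of_comp_eq (A := ℝ) k.continuous continuous_const ?_ 0 rfl
    funext θ
    exact (hconst θ).trans (hconst 0).symm
  -- The angles 0 and 2π give the same point, hence the same `F`, but `θ` has changed by 2π.
  have h2π := congrFun hk (2 * Real.pi)
  simp [k] at h2π

/-- If a continuous planar vector field `f` on a bounded neighbourhood `U` of the origin lies, near
each boundary point `v`, in an open half-plane that does not meet the ray through `v`, then it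
vanishes somewhere in `U`. -/
theorem Complex.exists_eq_zero_of_frontier {U : Set ℂ} (hU : IsOpen U)
    (hb : Bornology.IsBounded U) (h0 : (0 : ℂ) ∈ U) {f : ℂ → ℂ} (hf : ContinuousOn f U)
    (h : ∀ v ∈ frontier U, ∃ u : ℂ, inner ℝ u v < 0 ∧
      ∀ᶠ y in nhdsWithin v U, 0 < inner ℝ u (f y)) : ∃ y ∈ U, f y = 0 := by
  -- Every zero of the cut-off field below lies in `S`; including 0 forces `χ 0 = 1`, which excludes
  -- a spurious zero at the origin.
  set S : Set ℂ := insert 0 {y | y ∈ U ∧ ∃ t : ℝ, 0 ≤ t ∧ f y = t • y} with hS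
  have hSU : S ⊆ U := by
    rintro y (rfl | hy)
    exacts [h0, hy.1]
  have hcl : closure S ⊆ U := by
    intro v hv
    by_contra hvU
    have hvf : v ∈ frontier U := by
      rw [hU.frontier_eq]
      exact ⟨closure_mono hSU hv, hvU⟩
    obtain ⟨u, hu, hev⟩ := h v hvf
    have h1 : ∀ᶠ y in nhds v, inner ℝ u y < 0 :=
      (Continuous.tendsto (by fun_prop : Continuous fun y : ℂ => inner ℝ u y) v).eventually
        (gt_mem_nhds hu)
    have h2 := h1.and (eventually_nhdsWithin_iff.1 hev)
    obtain ⟨y, hyS, hy1, hy2⟩ := (mem_closure_iff_frequently.1 hv).and_eventually h2 |>.exists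
    rcases hyS with rfl | ⟨hyU, t, ht, hyt⟩
    · simp at hy1
    · have h3 := hy2 hyU
      rw [hyt, inner_smul_right] at h3
      nlinarith
  have hScomp : IsCompact (closure S) := (hb.subset hSU).isCompact_closure
  obtain ⟨K, -, hKc, hSK, hKU⟩ := exists_compact_closed_between hScomp hU hcl
  obtain ⟨χ, hχ1, hχ0, -, hχI⟩ := exists_continuous_one_zero_of_isCompact hScomp
    (isOpen_interior (s := K)).isClosed_compl (Set.disjoint_compl_right_iff_subset.2 hSK)
  have hχK : ∀ y, y ∉ K → χ y = 0 := fun y hy => hχ0 fun h' => hy (interior_subset h')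
  have hcont : Continuous fun y => χ y • f y := by
    rw [continuous_iff_continuousAt]
    intro y
    by_cases hy : y ∈ U
    · exact χ.continuous.continuousAt.smul (hf.continuousAt (hU.mem_nhds hy))
    · have hyK : y ∈ Kᶜ := fun h' => hy (hKU h')
      refine (continuousAt_const (y := (0 : ℂ))).congr ?_
      filter_upwards [hKc.isOpen_compl.mem_nhds hyK] with z hz
      simp [hχK z hz]
  obtain ⟨R, hR, hUR⟩ := hb.subset_ball_lt 0 0
  -- Interpolation between `f` near `S` and minus the identity outside `K`.
  obtain ⟨y, hy⟩ := Complex.exists_eq_zero_of_eq_neg_of_le_norm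
    (g := fun y => χ y • f y - (1 - χ y) • y) (by fun_prop) hR fun z hz => by
      have hzU : z ∉ U := fun h' => by simpa using (mem_ball_zero_iff.1 (hUR h')).trans_le hz
      simp [hχK z fun h' => hzU (hKU h')]
  have hy' : χ y • f y = (1 - χ y) • y := sub_eq_zero.1 hy
  have hyS : y ∈ S := by
    rcases eq_or_ne (χ y) 0 with h0' | h0'
    · left
      simpa [h0'] using hy'.symm
    · right
      refine ⟨?_, (χ y)⁻¹ * (1 - χ y), ?_, ?_⟩
      · by_contra hyU
        exact h0' (hχK y fun h' => hyU (hKU h'))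
      · have := hχI y
        exact mul_nonneg (inv_nonneg.2 this.1) (sub_nonneg.2 this.2)
      · rw [mul_smul, ← hy', inv_smul_smul₀ h0']
  have h1 : χ y = 1 := hχ1 (subset_closure hyS)
  exact ⟨y, hSU hyS, by simpa [h1] using hy'⟩

/-! ### Linear algebra of Gale duals -/

namespace GaleDuality

open Matrix

theorem isGaleDual_iff {r n m : ℕ} {M : Matrix (Fin r) (Fin n) ℝ} {N : Matrix (Fin n) (Fin m) ℝ} :
    IsGaleDual M N ↔ Function.Injective N.mulVec ∧
      LinearMap.range N.mulVecLin = LinearMap.ker M.mulVecLin := by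
  rw [IsGaleDual, Matrix.mulVec_injective_iff, Matrix.range_mulVecLin]

theorem IsGaleDual.mulVec_mulVec {r n m : ℕ} {M : Matrix (Fin r) (Fin n) ℝ}
    {N : Matrix (Fin n) (Fin m) ℝ} (h : IsGaleDual M N) (z : Fin m → ℝ) :
    M *ᵥ (N *ᵥ z) = 0 := by
  have : N *ᵥ z ∈ LinearMap.ker M.mulVecLin := (isGaleDual_iff.1 h).2 ▸ ⟨z, rfl⟩
  simpa using this

/-- In a Gale dual of a uniform matrix, every family of `m` rows spans. -/
theorem IsGaleDual.eq_zero_of_card_le {r n m : ℕ} {M : Matrix (Fin r) (Fin n) ℝ}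
    {N : Matrix (Fin n) (Fin m) ℝ} (hM : Uniform M) (h : IsGaleDual M N) (hn : n = r + m)
    {S : Finset (Fin n)} (hS : m ≤ S.card) {z : Fin m → ℝ} (hz : ∀ i ∈ S, (N *ᵥ z) i = 0) :
    z = 0 := by
  have hcard : (Sᶜ).card ≤ r := by
    rw [Finset.card_compl, Fintype.card_fin]
    omega
  -- `N *ᵥ z` is a kernel vector of `M` supported on `T`; padding `T` to size `r` makes the relevant
  -- minor square.
  obtain ⟨T, hST, hT⟩ := Finset.exists_superset_card_eq hcard (by simp; omega)
  let e : Fin r ≃ T := (Finset.equivFinOfCardEq hT).symm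
  set s : Fin r → Fin n := fun i => e i with hs
  have hsinj : Function.Injective s := Subtype.val_injective.comp e.injective
  have hdet := hM s hsinj
  have hzero : ∀ i, i ∉ T → (N *ᵥ z) i = 0 := fun i hi => by
    refine hz i ?_
    by_contra hiS
    exact hi (hST (Finset.mem_compl.2 hiS))
  have hsub : (M.submatrix id s) *ᵥ (fun i => (N *ᵥ z) (s i)) = 0 := by
    ext q
    have h1 := congrFun (h.mulVec_mulVec z) q
    simp only [Matrix.mulVec, dotProduct, Matrix.submatrix_apply, id, Pi.zero_apply] at h1 ⊢
    rw [← h1, ← Finset.sum_subset (Finset.subset_univ T)]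
    · rw [← Finset.sum_coe_sort T]
      exact e.sum_comp (fun i : T => M q i * ∑ x, N i x * z x)
    · intro i _ hi
      have := hzero i hi
      simp only [Matrix.mulVec, dotProduct] at this
      rw [this, mul_zero]
  have hv := Matrix.eq_zero_of_mulVec_eq_zero hdet hsub
  have hNz : N *ᵥ z = 0 := by
    ext i
    by_cases hi : i ∈ T
    · have := congrFun hv (e.symm ⟨i, hi⟩)
      simpa [hs] using this
    · exact hzero i hi
  exact (isGaleDual_iff.1 h).1 (by simpa using hNz)

/-- In a Gale dual of a uniform matrix, every family of at most `m` rows is independent. -/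
theorem IsGaleDual.eq_zero_of_vecMul {r n m : ℕ} {M : Matrix (Fin r) (Fin n) ℝ}
    {N : Matrix (Fin n) (Fin m) ℝ} (hM : Uniform M) (h : IsGaleDual M N) (hn : n = r + m)
    {S : Finset (Fin n)} (hS : S.card ≤ m) {t : Fin n → ℝ} (ht : ∀ i ∉ S, t i = 0)
    (htN : ∑ i, t i • N.row i = 0) : t = 0 := by
  obtain ⟨T, hST, hT⟩ := Finset.exists_superset_card_eq hS (by simp; omega)
  let e : Fin m ≃ T := (Finset.equivFinOfCardEq hT).symm
  set s : Fin m → Fin n := fun i => e i with hs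
  have hdet : (N.submatrix s id).det ≠ 0 := by
    intro h0
    obtain ⟨z, hz0, hz⟩ := Matrix.exists_mulVec_eq_zero_iff.2 h0
    refine hz0 (h.eq_zero_of_card_le hM hn (S := T) hT.ge fun i hi => ?_)
    have := congrFun hz (e.symm ⟨i, hi⟩)
    simpa [hs, Matrix.mulVec, dotProduct] using this
  have htT : ∀ i, i ∉ T → t i = 0 := fun i hi => ht i fun h' => hi (hST h')
  have hv : (fun i => t (s i)) ᵥ* (N.submatrix s id) = 0 := by
    ext j
    have h1 := congrFun htN j
    simp only [Finset.sum_apply, Pi.smul_apply, Matrix.row, smul_eq_mul, Pi.zero_apply] at h1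
    simp only [Matrix.vecMul, dotProduct, Matrix.submatrix_apply, id, Pi.zero_apply]
    rw [← h1, ← Finset.sum_subset (Finset.subset_univ T)]
    · rw [← Finset.sum_coe_sort T]
      exact e.sum_comp (fun i : T => t i * N i j)
    · intro i _ hi
      simp [htT i hi]
  have h0 := Matrix.eq_zero_of_vecMul_eq_zero hdet hv
  ext i
  by_cases hi : i ∈ T
  · have := congrFun h0 (e.symm ⟨i, hi⟩)
    simpa [hs] using this
  · exact htT i hi

theorem IsGaleDual.exists_eq_mul {r n m : ℕ} {M : Matrix (Fin r) (Fin n) ℝ}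
    {N N' : Matrix (Fin n) (Fin m) ℝ} (h : IsGaleDual M N) (h' : IsGaleDual M N') :
    ∃ g : Matrix (Fin m) (Fin m) ℝ, N' = N * g := by
  have : ∀ j, ∃ z, N *ᵥ z = N'.col j := fun j => by
    have : N'.col j ∈ LinearMap.range N.mulVecLin := by
      rw [(isGaleDual_iff.1 h).2, ← (isGaleDual_iff.1 h').2]
      exact ⟨Pi.single j 1, by simp⟩
    simpa using this
  choose z hz using this
  refine ⟨Matrix.of fun i j => z j i, ?_⟩
  ext i j
  have := congrFun (hz j) i
  simpa [Matrix.mul_apply, Matrix.mulVec, dotProduct] using this.symm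

theorem IsGaleDual.mul {r n m : ℕ} {M : Matrix (Fin r) (Fin n) ℝ}
    {N : Matrix (Fin n) (Fin m) ℝ} (h : IsGaleDual M N) {g : Matrix (Fin m) (Fin m) ℝ}
    (hg : IsUnit g) : IsGaleDual M (N * g) := by
  rw [isGaleDual_iff] at h ⊢
  have hgs : Function.Surjective g.mulVecLin := Matrix.mulVec_surjective_iff_isUnit.2 hg
  refine ⟨?_, ?_⟩
  · have : (N * g).mulVec = N.mulVec ∘ g.mulVec := by
      ext v
      simp [Matrix.mulVec_mulVec]
    rw [this]
    exact h.1.comp (Matrix.mulVec_injective_iff_isUnit.2 hg)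
  · rw [Matrix.mulVecLin_mul, LinearMap.range_comp_of_range_eq_top _ (LinearMap.range_eq_top.2 hgs),
      h.2]

theorem Uniform.exists_isGaleDual {r n m : ℕ} {M : Matrix (Fin r) (Fin n) ℝ} (hM : Uniform M)
    (hn : n = r + m) : ∃ N : Matrix (Fin n) (Fin m) ℝ, IsGaleDual M N := by
  have hdet := hM (Fin.castLE (by omega)) (Fin.castLE_injective _)
  have hsurj : Function.Surjective M.mulVecLin := by
    intro w
    obtain ⟨v, hv⟩ := Matrix.mulVec_surjective_iff_isUnit.2
      ((Matrix.isUnit_iff_isUnit_det _).2 hdet.isUnit) w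
    refine ⟨∑ i, v i • Pi.single (Fin.castLE (by omega) i) 1, ?_⟩
    rw [← hv]
    ext q
    simp [Matrix.mulVec, dotProduct, mul_comm]
  have hfin : Module.finrank ℝ (LinearMap.ker M.mulVecLin) = m := by
    have := M.mulVecLin.finrank_range_add_finrank_ker
    rw [LinearMap.range_eq_top.2 hsurj, finrank_top] at this
    simp only [Module.finrank_fintype_fun_eq_card, Fintype.card_fin] at this
    omega
  let b := Module.finBasisOfFinrankEq ℝ _ hfin
  refine ⟨Matrix.of fun i j => (b j : Fin n → ℝ) i, ?_, ?_⟩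
  · exact b.linearIndependent.map' (Submodule.subtype _) (Submodule.ker_subtype _)
  · have hr : Set.range (Matrix.of fun i j => (b j : Fin n → ℝ) i).col =
        (Submodule.subtype _) '' Set.range b := by
      rw [← Set.range_comp]
      rfl
    rw [hr, Submodule.span_image, b.span_eq, Submodule.map_subtype_top]

/-! ### Geometry of `Δ_P` -/

/-- The segment from a point satisfying the weak inequalities to a point of `Δ_P` lies in `Δ_P`,
apart from its first endpoint. -/
theorem closure_delta {n k : ℕ} {D : Matrix (Fin n) (Fin (k + 1)) ℝ} (hD : (delta D).Nonempty) :
    closure (delta D) = {y | (∀ i, 0 ≤ D.row i ⬝ᵥ y) ∧ y 0 = 1} := by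
  apply subset_antisymm
  · refine closure_minimal (fun y hy => ⟨fun i => (hy.1 i).le, hy.2⟩) ?_
    have h1 : IsClosed {y : Fin (k + 1) → ℝ | ∀ i, 0 ≤ D.row i ⬝ᵥ y} := by
      rw [Set.ofPred_forall]
      exact isClosed_iInter fun i => isClosed_le continuous_const
        (continuous_const.dotProduct continuous_id)
    exact h1.inter (isClosed_eq (continuous_apply 0) continuous_const)
  · rintro y ⟨hy, hy0⟩
    obtain ⟨c, hc, hc0⟩ := hD
    have ht : Filter.Tendsto (fun s : ℝ => y + s • (c - y)) (nhdsWithin 0 (Set.Ioo 0 1))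
        (nhds y) := by
      have : Continuous fun s : ℝ => y + s • (c - y) := by fun_prop
      simpa using (this.tendsto 0).mono_left nhdsWithin_le_nhds
    have : (nhdsWithin (0 : ℝ) (Set.Ioo 0 1)).NeBot := by
      rw [← mem_closure_iff_nhdsWithin_neBot, closure_Ioo zero_ne_one]
      simp
    refine mem_closure_of_tendsto ht ?_
    filter_upwards [self_mem_nhdsWithin] with s hs
    refine ⟨fun i => ?_, by simp [hc0, hy0]⟩
    have h1 := hy i
    have h2 := hc i
    have h3 : D.row i ⬝ᵥ (y + s • (c - y)) =
        (1 - s) * (D.row i ⬝ᵥ y) + s * (D.row i ⬝ᵥ c) := by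
      simp only [dotProduct_add, dotProduct_smul, dotProduct_sub, smul_eq_mul]
      ring
    rw [h3]
    have := mul_nonneg (sub_nonneg.2 hs.2.le) h1
    have := mul_pos hs.1 h2
    linarith

/-- A bounded set has no nonzero recession direction. -/
theorem eq_zero_of_zero_of_nonneg {n k : ℕ} {D : Matrix (Fin n) (Fin (k + 1)) ℝ}
    (hD : (delta D).Nonempty) (hb : Bornology.IsBounded (delta D)) {w : Fin (k + 1) → ℝ}
    (hw : ∀ i, 0 ≤ D.row i ⬝ᵥ w) (hw0 : w 0 = 0) : w = 0 := by
  by_contra hne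
  obtain ⟨c, hc, hc0⟩ := hD
  obtain ⟨R, hR⟩ := hb.exists_norm_le
  have hwn : 0 < ‖w‖ := norm_pos_iff.2 hne
  have hR0 : 0 ≤ R := (norm_nonneg c).trans (hR c ⟨hc, hc0⟩)
  -- Chosen so that `‖s • w‖ = R + ‖c‖ + 1`, which pushes `c + s • w` out of the ball of radius `R`.
  set s := (R + ‖c‖ + 1) / ‖w‖ with hs
  have hs0 : 0 ≤ s := by positivity
  have h1 : c + s • w ∈ delta D := by
    refine ⟨fun i => ?_, by simp [hc0, hw0]⟩
    rw [dotProduct_add, dotProduct_smul, smul_eq_mul]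
    have := hc i
    have := mul_nonneg hs0 (hw i)
    linarith
  have h2 := hR _ h1
  have h3 : ‖s • w‖ ≤ ‖c + s • w‖ + ‖c‖ := by
    simpa using norm_sub_le (c + s • w) c
  rw [norm_smul, Real.norm_of_nonneg hs0, hs, div_mul_cancel₀ _ hwn.ne'] at h3
  linarith

/-- If `w 0` were negative, `w - w 0 • c` would be a recession direction with strictly positive
products. -/
theorem pos_of_nonneg {n k : ℕ} {D : Matrix (Fin n) (Fin (k + 1)) ℝ} [NeZero n]
    (hD : (delta D).Nonempty) (hb : Bornology.IsBounded (delta D)) {w : Fin (k + 1) → ℝ}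
    (hw : ∀ i, 0 ≤ D.row i ⬝ᵥ w) (hne : w ≠ 0) : 0 < w 0 := by
  by_contra! h0
  rcases h0.eq_or_lt with h0 | h0
  · exact hne (eq_zero_of_zero_of_nonneg hD hb hw h0)
  · obtain ⟨c, hc, hc0⟩ := id hD
    have h1 : ∀ i, 0 < D.row i ⬝ᵥ (w - w 0 • c) := fun i => by
      rw [dotProduct_sub, dotProduct_smul, smul_eq_mul]
      nlinarith [hw i, hc i]
    have h2 := eq_zero_of_zero_of_nonneg hD hb (fun i => (h1 i).le) (by simp [hc0])
    have h3 := h1 0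
    simp [h2] at h3

/-! ### Cones of rows and minimal generators -/

theorem smul_add_smul_mem_closedRowCone {n m : ℕ} {D : Matrix (Fin n) (Fin m) ℝ}
    {K : Set (Fin n)} {v w : Fin m → ℝ} (hv : v ∈ closedRowCone D K) (hw : w ∈ closedRowCone D K)
    {p q : ℝ} (hp : 0 ≤ p) (hq : 0 ≤ q) : p • v + q • w ∈ closedRowCone D K := by
  obtain ⟨t, ht, htK, rfl⟩ := hv
  obtain ⟨u, hu, huK, rfl⟩ := hw
  refine ⟨p • t + q • u, fun i => ?_, fun i hi => ?_, ?_⟩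
  · exact add_nonneg (mul_nonneg hp (ht i)) (mul_nonneg hq (hu i))
  · simp [htK i hi, huK i hi]
  · simp [Finset.smul_sum, add_smul, Finset.sum_add_distrib, mul_smul]

theorem smul_mem_closedRowCone {n m : ℕ} {D : Matrix (Fin n) (Fin m) ℝ}
    {K : Set (Fin n)} {v : Fin m → ℝ} (hv : v ∈ closedRowCone D K)
    {p : ℝ} (hp : 0 ≤ p) : p • v ∈ closedRowCone D K := by
  simpa using smul_add_smul_mem_closedRowCone hv hv hp le_rfl

theorem row_mem_closedRowCone {n m : ℕ} (D : Matrix (Fin n) (Fin m) ℝ)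
    {K : Set (Fin n)} {l : Fin n} (hl : l ∈ K) : D.row l ∈ closedRowCone D K := by
  refine ⟨Pi.single l 1, fun i => ?_, fun i hi => ?_, ?_⟩
  · by_cases h : i = l
    · subst h; simp
    · simp [h]
  · have : i ≠ l := fun h => hi (h ▸ hl)
    simp [this]
  · rw [Finset.sum_eq_single l] <;> simp +contextual

theorem closedRowCone_mono {n m : ℕ} (D : Matrix (Fin n) (Fin m) ℝ) {J K : Set (Fin n)}
    (h : ∀ j ∈ J, D.row j ∈ closedRowCone D K) : closedRowCone D J ⊆ closedRowCone D K := by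
  rintro v ⟨t, ht, htJ, rfl⟩
  have : ∀ s : Finset (Fin n), ∑ i ∈ s, t i • D.row i ∈ closedRowCone D K := by
    intro s
    induction s using Finset.induction_on with
    | empty => exact ⟨0, by simp, by simp, by simp⟩
    | insert i s hi ih =>
      rw [Finset.sum_insert hi]
      by_cases hJ : i ∈ J
      · simpa using smul_add_smul_mem_closedRowCone (h i hJ) ih (ht i) zero_le_one
      · simpa [htJ i hJ] using ih
  exact this _

/-- A vector outside a cone generated by rows in an open half-space is separated from it. -/
theorem exists_dotProduct_neg {n m : ℕ} {D : Matrix (Fin n) (Fin m) ℝ} {y : Fin m → ℝ}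
    (hy : ∀ i, 0 < D.row i ⬝ᵥ y) {K : Set (Fin n)} {k : Fin n}
    (hk : D.row k ∉ closedRowCone D K) :
    ∃ v, D.row k ⬝ᵥ v < 0 ∧ ∀ l ∈ K, 0 ≤ D.row l ⬝ᵥ v := by
  -- Rescaling the rows to `⟨·, y⟩ = 1` replaces the cone by a compact convex section, to which
  -- Hahn-Banach applies.
  set q : Fin n → Fin m → ℝ := fun l => (D.row l ⬝ᵥ y)⁻¹ • D.row l with hq
  have hcomp : IsCompact (convexHull ℝ (q '' K)) := 
    (Set.toFinite (q '' K)).isCompact_convexHull (𝕜 := ℝ)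
  have hsub : convexHull ℝ (q '' K) ⊆ closedRowCone D K := by
    refine convexHull_min ?_ fun v hv w hw p r hp hr _ =>
      smul_add_smul_mem_closedRowCone hv hw hp hr
    rintro _ ⟨l, hl, rfl⟩
    exact smul_mem_closedRowCone (row_mem_closedRowCone D hl) (inv_nonneg.2 (hy l).le)
  have hqk : q k ∉ convexHull ℝ (q '' K) := fun h => hk <| by
    have := smul_mem_closedRowCone (hsub h) (hy k).le
    have hqk' : (D.row k ⬝ᵥ y) • q k = D.row k := by
      rw [hq, smul_smul, mul_inv_cancel₀ (hy k).ne', one_smul]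
    rwa [hqk'] at this
  obtain ⟨f, u, hu, huK⟩ := geometric_hahn_banach_point_closed (convex_convexHull ℝ _)
    hcomp.isClosed hqk
  set g : Fin m → ℝ := fun j => f (Pi.single j 1) with hg
  have hfg : ∀ x : Fin m → ℝ, f x = x ⬝ᵥ g := fun x => by
    conv_lhs => rw [← Finset.univ_sum_single x]
    rw [map_sum]
    refine Finset.sum_congr rfl fun j _ => ?_
    have : (Pi.single j (x j) : Fin m → ℝ) = x j • Pi.single j 1 := by
      rw [← Pi.single_smul]; simp
    rw [this, map_smul, smul_eq_mul]
  have key : ∀ l, D.row l ⬝ᵥ (g - u • y) = (D.row l ⬝ᵥ y) * (f (q l) - u) := fun l => by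
    have h1 := (hy l).ne'
    rw [dotProduct_sub, dotProduct_smul, ← hfg, hq, map_smul]
    simp only [smul_eq_mul]
    field_simp
  -- Since every `q l` pairs to 1 with `y`, subtracting `u • y` moves the separating level to 0.
  refine ⟨g - u • y, ?_, fun l hl => ?_⟩
  · rw [key]
    exact mul_neg_of_pos_of_neg (hy k) (sub_neg.2 hu)
  · rw [key]
    exact mul_nonneg (hy l).le
      (sub_nonneg.2 (huK _ (subset_convexHull ℝ _ ⟨l, hl, rfl⟩)).le)

theorem mem_closedRowCone_mul {n m : ℕ} {D : Matrix (Fin n) (Fin m) ℝ}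
    (g : Matrix (Fin m) (Fin m) ℝ) {K : Set (Fin n)} {v : Fin m → ℝ}
    (hv : v ∈ closedRowCone D K) : v ᵥ* g ∈ closedRowCone (D * g) K := by
  obtain ⟨t, ht, htK, rfl⟩ := hv
  refine ⟨t, ht, htK, ?_⟩
  ext j
  simp [Matrix.sum_vecMul, Matrix.smul_vecMul]
  rfl

/-- The generating index sets are the same for all Gale duals of a matrix. -/
theorem IsGaleDual.closedRowCone_eq_univ {r n m : ℕ} {M : Matrix (Fin r) (Fin n) ℝ}
    {N N' : Matrix (Fin n) (Fin m) ℝ} (h : IsGaleDual M N) (h' : IsGaleDual M N')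
    {J : Set (Fin n)} (hJ : closedRowCone N J = closedRowCone N Set.univ) :
    closedRowCone N' J = closedRowCone N' Set.univ := by
  obtain ⟨g, rfl⟩ := h.exists_eq_mul h'
  refine subset_antisymm (closedRowCone_mono _ fun j _ => row_mem_closedRowCone _ trivial)
    (closedRowCone_mono _ fun j _ => ?_)
  have : N.row j ∈ closedRowCone N J := hJ ▸ row_mem_closedRowCone N trivial
  have h2 := mem_closedRowCone_mul g this
  have h3 : N.row j ᵥ* g = (N * g).row j := by
    ext q
    rfl
  rwa [h3] at h2

/-- Two Gale duals differ by a linear change of coordinates, which maps one row cone onto the other.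
This makes `I_C` depend on `C` only. -/
theorem IsGaleDual.isMinimalGenerating {r n m : ℕ} {M : Matrix (Fin r) (Fin n) ℝ}
    {N N' : Matrix (Fin n) (Fin m) ℝ} (h : IsGaleDual M N) (h' : IsGaleDual M N')
    {J : Set (Fin n)} (hJ : IsMinimalGenerating N J) : IsMinimalGenerating N' J :=
  ⟨h.closedRowCone_eq_univ h' hJ.1, fun _ hK hKJ => hJ.2 (h'.closedRowCone_eq_univ h hK) hKJ⟩

theorem IsMinimalGenerating.row_mem {n m : ℕ} {D : Matrix (Fin n) (Fin m) ℝ} {I : Set (Fin n)}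
    (hI : IsMinimalGenerating D I) (i : Fin n) : D.row i ∈ closedRowCone D I :=
  hI.1 ▸ row_mem_closedRowCone D (Set.mem_univ i)

theorem IsMinimalGenerating.row_notMem {n m : ℕ} {D : Matrix (Fin n) (Fin m) ℝ} {I : Set (Fin n)}
    (hI : IsMinimalGenerating D I) {k : Fin n} (hk : k ∈ I) :
    D.row k ∉ closedRowCone D (I \ {k}) := by
  intro h
  have hgen : closedRowCone D (I \ {k}) = closedRowCone D Set.univ := by
    refine subset_antisymm (closedRowCone_mono _ fun j _ => row_mem_closedRowCone _ trivial) ?_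
    rw [← hI.1]
    refine closedRowCone_mono _ fun j hj => ?_
    rcases eq_or_ne j k with rfl | hjk
    · exact h
    · exact row_mem_closedRowCone _ ⟨hj, hjk⟩
  exact (hI.2 hgen Set.sdiff_subset hk).2 rfl

section Uniform

variable {d n : ℕ} {C : Matrix (Fin d) (Fin n) ℝ} {D : Matrix (Fin n) (Fin (2 + 1)) ℝ}
  {I : Set (Fin n)}

/-- With a single generator, any other row would be a multiple of it, against the independence of
pairs of rows. -/
theorem IsMinimalGenerating.nontrivial (hC : Uniform C) (hn : n = d + (2 + 1))
    (hD : IsGaleDual C D) (hI : IsMinimalGenerating D I) : I.Nontrivial := by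
  rw [← Set.not_subsingleton_iff]
  intro hs
  have : NeZero n := ⟨by omega⟩
  have : Nontrivial (Fin n) := Fin.nontrivial_iff_two_le.2 (by omega)
  obtain ⟨k, hk⟩ : ∃ k, I ⊆ {k} := by
    rcases hs.eq_empty_or_singleton with rfl | ⟨k, rfl⟩
    exacts [⟨0, by simp⟩, ⟨k, subset_rfl⟩]
  obtain ⟨j, hj⟩ := exists_ne k
  obtain ⟨t, -, htI, ht⟩ := hI.row_mem j
  have h0 := hD.eq_zero_of_vecMul hC hn (S := {j, k}) (t := t - Pi.single j 1)
    (Finset.card_le_two.trans (by norm_num)) (fun i hi => by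
      simp only [Finset.mem_insert, Finset.mem_singleton, not_or] at hi
      simp [hi.1, htI i fun h => hi.2 (hk h)]) (by
      simp only [Pi.sub_apply, sub_smul, Finset.sum_sub_distrib, ← ht]
      rw [Finset.sum_eq_single j] <;> simp +contextual)
  have := congrFun h0 j
  simp [htI j fun h => hj (hk h)] at this

/-- The members of a minimal generating set are the rows vanishing at some point of the closure
of `Δ_P`. -/
theorem IsMinimalGenerating.mem_iff (hC : Uniform C) (hn : n = d + (2 + 1))
    (hD : IsGaleDual C D) (hne : (delta D).Nonempty) (hb : Bornology.IsBounded (delta D))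
    (hI : IsMinimalGenerating D I) {k : Fin n} :
    k ∈ I ↔ ∃ y ∈ closure (delta D), D.row k ⬝ᵥ y = 0 := by
  have : NeZero n := ⟨by omega⟩
  rw [closure_delta hne]
  constructor
  · intro hk
    obtain ⟨c, hc, hc0⟩ := id hne
    obtain ⟨v, hvk, hv⟩ := exists_dotProduct_neg hc (hI.row_notMem hk)
    -- Moving the separating vector towards `c` until its product with row `k` is 0 makes its
    -- products with the other generators positive.
    set s : ℝ := -(D.row k ⬝ᵥ v) / (D.row k ⬝ᵥ c) with hs
    have hs0 : 0 < s := div_pos (neg_pos.2 hvk) (hc k)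
    set w := v + s • c with hw
    have hwk : D.row k ⬝ᵥ w = 0 := by
      rw [hw, dotProduct_add, dotProduct_smul, smul_eq_mul, hs, div_mul_cancel₀ _ (hc k).ne']
      ring
    have hwpos : ∀ l ∈ I, l ≠ k → 0 < D.row l ⬝ᵥ w := fun l hl hlk => by
      rw [hw, dotProduct_add, dotProduct_smul, smul_eq_mul]
      have := hv l ⟨hl, hlk⟩
      have := mul_pos hs0 (hc l)
      linarith
    have hwI : ∀ l ∈ I, 0 ≤ D.row l ⬝ᵥ w := fun l hl => by
      rcases eq_or_ne l k with rfl | hlk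
      exacts [hwk.ge, (hwpos l hl hlk).le]
    have hwall : ∀ l, 0 ≤ D.row l ⬝ᵥ w := fun l => by
      obtain ⟨t, ht, htI, hl⟩ := hI.row_mem l
      rw [hl, sum_dotProduct]
      refine Finset.sum_nonneg fun i _ => ?_
      rw [smul_dotProduct, smul_eq_mul]
      by_cases hi : i ∈ I
      · exact mul_nonneg (ht i) (hwI i hi)
      · simp [htI i hi]
    have hw0 : w ≠ 0 := by
      obtain ⟨l, hl, hlk⟩ := (hI.nontrivial hC hn hD).exists_ne k
      intro h
      have := hwpos l hl hlk
      simp [h] at this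
    have hpos := pos_of_nonneg hne hb hwall hw0
    refine ⟨(w 0)⁻¹ • w, ⟨fun i => ?_, ?_⟩, ?_⟩
    · rw [dotProduct_smul]
      exact mul_nonneg (inv_nonneg.2 hpos.le) (hwall i)
    · simp [hpos.ne']
    · rw [dotProduct_smul, hwk, smul_zero]
  · rintro ⟨y, ⟨hy, hy0⟩, hky⟩
    by_contra hkI
    obtain ⟨t, ht, htI, hk⟩ := hI.row_mem k
    have hsum : ∑ i, t i * (D.row i ⬝ᵥ y) = 0 := by
      rw [← hky]
      conv_rhs => rw [hk, sum_dotProduct]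
      simp
    have hzero := (Finset.sum_eq_zero_iff_of_nonneg fun i _ => mul_nonneg (ht i) (hy i)).1 hsum
    set S : Finset (Fin n) := Finset.univ.filter fun i => D.row i ⬝ᵥ y = 0 with hS
    have hScard : S.card ≤ 2 + 1 := by
      by_contra! h
      have := hD.eq_zero_of_card_le hC hn h.le (z := y) fun i hi => (Finset.mem_filter.1 hi).2
      simp [this] at hy0
    -- Row `k` is a combination of generators active at `y`; at most three rows are active, so they
    -- are independent and the relation is trivial.
    have h0 := hD.eq_zero_of_vecMul hC hn (S := S) (t := t - Pi.single k 1) hScard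
      (fun i hi => by
        have h1 : D.row i ⬝ᵥ y ≠ 0 := fun h => hi (by simp [hS, h])
        have hik : i ≠ k := fun h => h1 (h ▸ hky)
        have h2 := (mul_eq_zero.1 (hzero i (Finset.mem_univ i))).resolve_right h1
        simp [hik, h2]) (by
        simp only [Pi.sub_apply, sub_smul, Finset.sum_sub_distrib, ← hk]
        rw [Finset.sum_eq_single k] <;> simp +contextual)
    have := congrFun h0 k
    simp [htI k hkI] at this

end Uniform

/-! ### Choice of `B` -/

/-- Among finitely many pairwise independent planar vectors `b m`, there are two vectors `b k` and
`b l` such that the open double wedge spanned by `b k` and `-b l` contains no `b m`. -/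
theorem exists_empty_double_wedge {n : ℕ} {V : Type*} [AddCommGroup V] [Module ℝ V]
    {b : Fin n → V} {I : Set (Fin n)} (hI : I.Nontrivial)
    (hb : ∀ i j, i ≠ j → ∀ s t : ℝ, s • b i + t • b j = 0 → s = 0 ∧ t = 0) :
    ∃ k ∈ I, ∃ l ∈ I, k ≠ l ∧ ∀ m ∈ I, ∀ x y : ℝ, 0 < x → 0 < y →
      b m ≠ x • b k - y • b l ∧ -b m ≠ x • b k - y • b l := by
  classical
  let W : Fin n → Fin n → Set (Fin n) := fun k l => {m | m ∈ I ∧ ∃ x y : ℝ, 0 < x ∧ 0 < y ∧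
    (b m = x • b k - y • b l ∨ -b m = x • b k - y • b l)}
  have hself : ∀ k l, k ≠ l → k ∉ W k l ∧ l ∉ W k l := by
    intro k l hkl
    refine ⟨?_, ?_⟩
    · rintro ⟨-, x, y, hx, hy, h | h⟩
      · have := (hb k l hkl (x - 1) (-y) (by linear_combination (norm := module) (-1 : ℝ) • h)).2
        linarith
      · have := (hb k l hkl (x + 1) (-y) (by linear_combination (norm := module) (-1 : ℝ) • h)).2
        linarith
    · rintro ⟨-, x, y, hx, hy, h | h⟩
      · have := (hb k l hkl x (-(y + 1)) (by linear_combination (norm := module) (-1 : ℝ) • h)).1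
        linarith
      · have := (hb k l hkl x (1 - y) (by linear_combination (norm := module) (-1 : ℝ) • h)).1
        linarith
  suffices H : ∀ N : ℕ, ∀ k ∈ I, ∀ l ∈ I, k ≠ l → (W k l).ncard ≤ N → ∃ k ∈ I, ∃ l ∈ I,
      k ≠ l ∧ W k l = ∅ by
    obtain ⟨k, hk, l, hl, hkl⟩ := hI
    obtain ⟨k, hk, l, hl, hkl, hW⟩ := H _ k hk l hl hkl le_rfl
    refine ⟨k, hk, l, hl, hkl, fun m hm x y hx hy => ⟨fun h => ?_, fun h => ?_⟩⟩
    · exact (Set.eq_empty_iff_forall_notMem.1 hW m) ⟨hm, x, y, hx, hy, Or.inl h⟩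
    · exact (Set.eq_empty_iff_forall_notMem.1 hW m) ⟨hm, x, y, hx, hy, Or.inr h⟩
  intro N
  induction N with
  | zero =>
    intro k hk l hl hkl h
    exact ⟨k, hk, l, hl, hkl, (Set.ncard_eq_zero (Set.toFinite _)).1 (Nat.le_zero.1 h)⟩
  | succ N ih =>
    intro k hk l hl hkl h
    rcases (W k l).eq_empty_or_nonempty with h0 | ⟨i, hi⟩
    · exact ⟨k, hk, l, hl, hkl, h0⟩
    have hik : i ≠ k := fun e => (hself k l hkl).1 (e ▸ hi)
    have hil : i ≠ l := fun e => (hself k l hkl).2 (e ▸ hi)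
    -- If `b i` is in the wedge it replaces `b k`; if `-b i` is, then `b i` replaces `b l`. The new
    -- wedge sits inside the old one and loses the index `i`.
    obtain ⟨hiI, x, y, hx, hy, h1 | h1⟩ := id hi
    · refine ih i hiI l hl hil (Nat.lt_succ_iff.1 (lt_of_lt_of_le (Set.ncard_lt_ncard ?_) h))
      refine ⟨?_, fun hsub => (hself i l hil).1 (hsub hi)⟩
      rintro m ⟨hm, x', y', hx', hy', h2⟩
      refine ⟨hm, x' * x, x' * y + y', by positivity, by positivity, ?_⟩
      have : x' • b i - y' • b l = (x' * x) • b k - (x' * y + y') • b l := by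
        rw [h1]; module
      rwa [this] at h2
    · refine ih k hk i hiI hik.symm
        (Nat.lt_succ_iff.1 (lt_of_lt_of_le (Set.ncard_lt_ncard ?_) h))
      refine ⟨?_, fun hsub => (hself k i hik.symm).2 (hsub hi)⟩
      rintro m ⟨hm, x', y', hx', hy', h2⟩
      refine ⟨hm, x' + y' * x, y' * y, by positivity, by positivity, ?_⟩
      have : x' • b k - y' • b i = (x' + y' * x) • b k - (y' * y) • b l := by
        rw [sub_eq_add_neg, ← smul_neg, h1]; module
      rwa [this] at h2

theorem IsGaleDual.pair_independent {r n m : ℕ} {M : Matrix (Fin r) (Fin n) ℝ}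
    {N : Matrix (Fin n) (Fin m) ℝ} (hM : Uniform M) (h : IsGaleDual M N) (hn : n = r + m)
    (hm : 2 ≤ m) {i j : Fin n} (hij : i ≠ j) {s t : ℝ} (hst : s • N.row i + t • N.row j = 0) :
    s = 0 ∧ t = 0 := by
  have h0 := h.eq_zero_of_vecMul hM hn (S := {i, j}) (t := Pi.single i s + Pi.single j t)
    (Finset.card_le_two.trans hm) (fun q hq => by
      simp only [Finset.mem_insert, Finset.mem_singleton, not_or] at hq
      simp [hq.1, hq.2]) (by
      simp only [Pi.add_apply, add_smul, Finset.sum_add_distrib]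
      rw [Finset.sum_eq_single i, Finset.sum_eq_single j] <;> simp +contextual [hst])
  have hi := congrFun h0 i
  have hj := congrFun h0 j
  simp only [Pi.add_apply, Pi.single_eq_same, Pi.single_eq_of_ne hij, Pi.single_eq_of_ne hij.symm,
    Pi.zero_apply, add_zero, zero_add] at hi hj
  exact ⟨hi, hj⟩

/-- A change of basis sends the two rows bounding an empty double wedge to (1,0) and (0,-1); the
wedge becomes the union of the open first and third quadrants. -/
theorem Uniform.exists_normalized_isGaleDual {r n : ℕ} {M : Matrix (Fin r) (Fin n) ℝ}
    (hM : Uniform M) (hn : n = r + 2) {I : Set (Fin n)} (hI : I.Nontrivial) :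
    ∃ B : Matrix (Fin n) (Fin 2) ℝ, IsGaleDual M B ∧
      (∃ k ∈ I, 0 < B k 0 ∧ B k 1 = 0) ∧ (∃ l ∈ I, B l 0 = 0 ∧ B l 1 < 0) ∧
      ∀ m ∈ I, ¬ (0 < B m 0 ∧ 0 < B m 1) ∧ ¬ (B m 0 < 0 ∧ B m 1 < 0) := by
  obtain ⟨N, hN⟩ := hM.exists_isGaleDual hn
  obtain ⟨k, hk, l, hl, hkl, hW⟩ := exists_empty_double_wedge (b := N.row) hI
    fun i j hij s t hst => hN.pair_independent hM hn le_rfl hij hst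
  have hdet : IsUnit (N.submatrix ![k, l] id) := by
    rw [Matrix.isUnit_iff_isUnit_det, isUnit_iff_ne_zero]
    intro h0
    obtain ⟨z, hz0, hz⟩ := Matrix.exists_mulVec_eq_zero_iff.2 h0
    refine hz0 (hN.eq_zero_of_card_le hM hn (S := {k, l}) (Finset.card_pair hkl).ge fun i hi => ?_)
    simp only [Finset.mem_insert, Finset.mem_singleton] at hi
    rcases hi with rfl | rfl
    · exact congrFun hz 0
    · exact congrFun hz 1
  set T : Matrix (Fin 2) (Fin 2) ℝ := !![1, 0; 0, -1] with hT
  have hTu : IsUnit T := by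
    rw [Matrix.isUnit_iff_isUnit_det, isUnit_iff_ne_zero]
    simp [hT, Matrix.det_fin_two]
  set g := (N.submatrix ![k, l] id)⁻¹ * T with hg
  have hgu : IsUnit g := ((Matrix.isUnit_nonsing_inv_iff).2 hdet).mul hTu
  have hrow : (N * g).submatrix ![k, l] id = T := by
    rw [Matrix.submatrix_mul _ _ _ id _ Function.bijective_id, Matrix.submatrix_id_id, hg,
      Matrix.mul_nonsing_inv_cancel_left _ _ ((Matrix.isUnit_iff_isUnit_det _).1 hdet)]
  have hrow' : ∀ p q, (N * g) (![k, l] p) q = T p q := fun p q => congrFun (congrFun hrow p) q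
  have hk0 : (N * g) k 0 = 1 := hrow' 0 0
  have hk1 : (N * g) k 1 = 0 := hrow' 0 1
  have hl0 : (N * g) l 0 = 0 := hrow' 1 0
  have hl1 : (N * g) l 1 = -1 := hrow' 1 1
  have hcoord : ∀ m, N.row m = (N * g) m 0 • N.row k - (N * g) m 1 • N.row l := by
    intro m
    apply Matrix.vecMul_injective_of_isUnit hgu
    have hrg : ∀ i, N.row i ᵥ* g = (N * g).row i := fun i => by
      ext q
      rfl
    simp only [Matrix.sub_vecMul, Matrix.smul_vecMul, hrg]
    ext q
    fin_cases q <;> simp [hk0, hk1, hl0, hl1]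
  refine ⟨N * g, hN.mul hgu, ⟨k, hk, by rw [hk0]; norm_num, hk1⟩,
    ⟨l, hl, hl0, by rw [hl1]; norm_num⟩, fun m hm => ⟨fun h => ?_, fun h => ?_⟩⟩
  · exact (hW m hm _ _ h.1 h.2).1 (hcoord m)
  · refine (hW m hm _ _ (neg_pos.2 h.1) (neg_pos.2 h.2)).2 ?_
    conv_lhs => rw [hcoord m]
    module

/-! ### Condition (1) from condition (2) -/

section Uniform

variable {d n : ℕ} {C : Matrix (Fin d) (Fin n) ℝ} {D : Matrix (Fin n) (Fin (2 + 1)) ℝ}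
  {I : Set (Fin n)}

theorem row_dotProduct_three (D : Matrix (Fin n) (Fin (2 + 1)) ℝ) (i : Fin n)
    (y : Fin (2 + 1) → ℝ) : D.row i ⬝ᵥ y = D i 0 * y 0 + D i 1 * y 1 + D i 2 * y 2 := by
  simp [dotProduct, Fin.sum_univ_three]

theorem IsGaleDual.eq_or_eq_of_dotProduct_eq_zero (hC : Uniform C) (hn : n = d + (2 + 1))
    (hD : IsGaleDual C D) {y : Fin (2 + 1) → ℝ} (hy0 : y 0 = 1) {i j : Fin n} (hij : i ≠ j)
    (hi : D.row i ⬝ᵥ y = 0) (hj : D.row j ⬝ᵥ y = 0) {k : Fin n} (hk : D.row k ⬝ᵥ y = 0) :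
    k = i ∨ k = j := by
  by_contra! h
  have := hD.eq_zero_of_card_le hC hn (S := {k, i, j}) (z := y)
    (Finset.card_eq_three.2 ⟨k, i, j, h.1, h.2, hij, rfl⟩).ge fun q hq => by
      simp only [Finset.mem_insert, Finset.mem_singleton] at hq
      rcases hq with rfl | rfl | rfl <;> assumption
  simp [this] at hy0

/-- Affine functions with parallel linear parts and a common zero are dependent, whereas two rows of
`D` are independent. -/
theorem IsGaleDual.det_ne_zero_of_vertex (hC : Uniform C) (hn : n = d + (2 + 1))
    (hD : IsGaleDual C D) {y : Fin (2 + 1) → ℝ} (hy0 : y 0 = 1) {i j : Fin n} (hij : i ≠ j)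
    (hi : D.row i ⬝ᵥ y = 0) (hj : D.row j ⬝ᵥ y = 0) :
    D i 1 * D j 2 - D i 2 * D j 1 ≠ 0 := by
  intro h0
  rw [row_dotProduct_three, hy0] at hi hj
  have hind := fun s t h => hD.pair_independent hC hn (by norm_num) hij (s := s) (t := t) h
  have h2 := hind (D j 2) (-D i 2) (by
    ext q
    fin_cases q
    · simp; linear_combination D j 2 * hi - D i 2 * hj - y 1 * h0
    · simp; linear_combination h0
    · simp; ring)
  have h1 := hind (D j 1) (-D i 1) (by
    ext q
    fin_cases q
    · simp; linear_combination D j 1 * hi - D i 1 * hj + y 2 * h0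
    · simp; ring
    · simp; linear_combination -h0)
  have h3 := hind 1 0 (by
    have e1 : D i 1 = 0 := neg_eq_zero.1 h1.2
    have e2 : D i 2 = 0 := neg_eq_zero.1 h2.2
    ext q
    fin_cases q
    · simpa [e1, e2] using hi
    · simpa using e1
    · simpa using e2)
  exact one_ne_zero h3.1

/-- At a vertex of `Δ_P`, the normal cone contains no normal vector of a third edge. -/
theorem IsMinimalGenerating.false_of_normal_mem (hC : Uniform C) (hn : n = d + (2 + 1))
    (hD : IsGaleDual C D) (hne : (delta D).Nonempty) (hb : Bornology.IsBounded (delta D))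
    (hI : IsMinimalGenerating D I) {y : Fin (2 + 1) → ℝ} (hy : y ∈ closure (delta D))
    {i j k : Fin n} (hij : i ≠ j) (hi : D.row i ⬝ᵥ y = 0) (hj : D.row j ⬝ᵥ y = 0) (hk : k ∈ I)
    (hki : k ≠ i) (hkj : k ≠ j) {p q : ℝ} (hp : 0 ≤ p) (hq : 0 ≤ q)
    (h1 : D k 1 = p * D i 1 + q * D j 1) (h2 : D k 2 = p * D i 2 + q * D j 2) : False := by
  obtain ⟨z, hz, hkz⟩ := (hI.mem_iff hC hn hD hne hb).1 hk
  rw [closure_delta hne] at hy hz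
  obtain ⟨hy, hy0⟩ := hy
  obtain ⟨hz, hz0⟩ := hz
  have hky : D.row k ⬝ᵥ y = 0 := by
    refine le_antisymm ?_ (hy k)
    have hzi := mul_nonneg hp (hz i)
    have hzj := mul_nonneg hq (hz j)
    -- On `y 0 = 1`, row `k` differs from the combination of rows `i` and `j` by a constant; this is
    -- evaluated at `y` and at `z`.
    have key : D.row k ⬝ᵥ y = -(p * (D.row i ⬝ᵥ z)) - q * (D.row j ⬝ᵥ z) := by
      simp only [row_dotProduct_three, hy0, hz0] at hi hj hkz ⊢
      linear_combination hkz + p * hi + q * hj + (y 1 - z 1) * h1 + (y 2 - z 2) * h2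
    linarith
  rcases hD.eq_or_eq_of_dotProduct_eq_zero hC hn hy0 hij hi hj hky with h | h
  exacts [hki h, hkj h]

/-- A weakly mixed `B_L` forces opposite sign patterns at a vertex; its normal cone then captures
the normal of row `k` or of row `l`. -/
theorem conditionOne_of_normalized {r : ℕ} {M : Matrix (Fin r) (Fin n) ℝ} (hM : Uniform M)
    (hr : n = r + 2) (hC : Uniform C) (hn : n = d + (2 + 1))
    (hD : IsGaleDual C D) (hne : (delta D).Nonempty) (hb : Bornology.IsBounded (delta D))
    (hI : IsMinimalGenerating D I) {B : Matrix (Fin n) (Fin 2) ℝ} (hB : IsGaleDual M B)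
    (hk : ∃ k ∈ I, 0 < B k 0 ∧ B k 1 = 0) (hl : ∃ l ∈ I, B l 0 = 0 ∧ B l 1 < 0)
    (hW : ∀ m ∈ I, ¬ (0 < B m 0 ∧ 0 < B m 1) ∧ ¬ (B m 0 < 0 ∧ B m 1 < 0))
    (h2 : ConditionTwo B D I) : ConditionOne B D I := by
  rintro L ⟨hLI, ⟨i₀, hi₀⟩, y, hy, hyL⟩ hmix
  have hycl := hy
  rw [closure_delta hne] at hy
  have hcol : ∀ q : Fin 2, ∀ i ∈ L, ∀ j ∈ L, B i q = 0 → B j q = 0 → i = j := by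
    intro q i _ j _ hi hj
    by_contra hij
    have := hB.eq_zero_of_card_le hM hr (S := {i, j}) (z := Pi.single q 1)
      (Finset.card_pair hij).ge fun m hm => by
        simp only [Finset.mem_insert, Finset.mem_singleton] at hm
        rcases hm with rfl | rfl <;> simpa
    simpa using congrFun this q
  have hrow : ∀ i, B i 0 = 0 → B i 1 = 0 → False := by
    intro i hi0 hi1
    have := hB.eq_zero_of_vecMul hM hr (S := {i}) (t := Pi.single i 1) (by simp)
      (fun j hj => by simp [Finset.notMem_singleton.1 hj]) (by
        rw [Finset.sum_eq_single i]
        · ext q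
          fin_cases q <;> simpa
        · simp +contextual
        · simp)
    simpa using congrFun this i
  have hposneg : ∀ q : Fin 2, ∀ i j : L, 0 < B i q → B j q < 0 → (i : Fin n) ≠ j := by
    intro q i j hi hj h
    rw [h] at hi
    exact lt_asymm hi hj
  have hm0 := hmix 0
  have hm1 := hmix 1
  simp only [Matrix.submatrix_apply, id] at hm0 hm1
  rcases hm0 with hm0 | ⟨⟨i, hi⟩, j, hj⟩
  · rcases hm1 with hm1 | ⟨⟨i, hi⟩, j, hj⟩
    · exact hrow i₀ (hm0 ⟨i₀, hi₀⟩) (hm1 ⟨i₀, hi₀⟩)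
    · exact hposneg 1 i j hi hj (hcol 0 i i.2 j j.2 (hm0 i) (hm0 j))
  · have hij := hposneg 0 i j hi hj
    rcases hm1 with hm1 | ⟨⟨i', hi'⟩, j', hj'⟩
    · exact hij (hcol 1 i i.2 j j.2 (hm1 i) (hm1 j))
    · have hi'j : (i' : Fin n) = j := by
        refine (hD.eq_or_eq_of_dotProduct_eq_zero hC hn hy.2 hij (hyL i i.2) (hyL j j.2)
          (hyL i' i'.2)).resolve_left fun h => ?_
        exact (hW i (hLI i.2)).1 ⟨hi, h ▸ hi'⟩
      have hj'i : (j' : Fin n) = i := by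
        refine (hD.eq_or_eq_of_dotProduct_eq_zero hC hn hy.2 hij (hyL i i.2) (hyL j j.2)
          (hyL j' j'.2)).resolve_right fun h => ?_
        exact (hW j (hLI j.2)).2 ⟨hj, h ▸ hj'⟩
      rw [hi'j] at hi'
      rw [hj'i] at hj'
      obtain ⟨k, hkI, hk0, hk1⟩ := hk
      obtain ⟨l, hlI, hl0, hl1⟩ := hl
      have ci := h2 i (hLI i.2)
      have cj := h2 j (hLI j.2)
      have ck := h2 k hkI
      have cl := h2 l hlI
      simp only [Fin.forall_fin_two, Fin.exists_fin_two] at ci cj ck cl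
      change (0 ≤ B i 0 * D i 1 ∧ 0 ≤ B i 1 * D i 2) ∧ _ at ci
      change (0 ≤ B j 0 * D j 1 ∧ 0 ≤ B j 1 * D j 2) ∧ _ at cj
      change _ ∧ (0 < B k 0 * D k 1 ∨ 0 < B k 1 * D k 2) ∧ (_ ∧ (B k 1 = 0 → D k 2 = 0)) at ck
      change _ ∧ (0 < B l 0 * D l 1 ∨ 0 < B l 1 * D l 2) ∧ ((B l 0 = 0 → D l 1 = 0) ∧ _) at cl
      have di1 : 0 ≤ D i 1 := nonneg_of_mul_nonneg_right ci.1.1 hi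
      have di2 : D i 2 ≤ 0 := nonpos_of_mul_nonneg_right ci.1.2 hj'
      have dj1 : D j 1 ≤ 0 := nonpos_of_mul_nonneg_right cj.1.1 hj
      have dj2 : 0 ≤ D j 2 := nonneg_of_mul_nonneg_right cj.1.2 hi'
      have dk2 : D k 2 = 0 := ck.2.2.2 hk1
      have dk1 : 0 ≤ D k 1 := by
        have := ck.2.1
        rw [hk1, zero_mul] at this
        exact (pos_of_mul_pos_right (this.resolve_right (lt_irrefl 0)) hk0.le).le
      have dl1 : D l 1 = 0 := cl.2.2.1 hl0
      have dl2 : D l 2 ≤ 0 := by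
        have := cl.2.1
        rw [hl0, zero_mul] at this
        exact nonpos_of_mul_nonneg_right (this.resolve_left (lt_irrefl 0)).le hl1
      have hki : k ≠ i := fun h => by rw [← h, hk1] at hj'; exact lt_irrefl 0 hj'
      have hkj : k ≠ j := fun h => by rw [← h, hk1] at hi'; exact lt_irrefl 0 hi'
      have hli : l ≠ i := fun h => by rw [← h, hl0] at hi; exact lt_irrefl 0 hi
      have hlj : l ≠ j := fun h => by rw [← h, hl0] at hj; exact lt_irrefl 0 hj
      have hdet := hD.det_ne_zero_of_vertex hC hn hy.2 hij (hyL i i.2) (hyL j j.2)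
      set e := D i 1 * D j 2 - D i 2 * D j 1 with he
      -- The orientation of the two normals decides whether their cone contains the third quadrant
      -- (use `l`) or the first (use `k`); `p` and `q` come from Cramer's rule.
      rcases hdet.lt_or_gt with hlt | hgt
      · refine hI.false_of_normal_mem hC hn hD hne hb hycl hij (hyL i i.2) (hyL j j.2) hlI hli hlj
          (p := -D l 2 * D j 1 / e) (q := D l 2 * D i 1 / e) ?_ ?_ ?_ ?_
        · exact div_nonneg_of_nonpos (mul_nonpos_of_nonneg_of_nonpos (by linarith) dj1) hlt.le
        · exact div_nonneg_of_nonpos (mul_nonpos_of_nonpos_of_nonneg dl2 di1) hlt.le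
        · rw [dl1]; field_simp; ring
        · field_simp; rw [he]; ring
      · refine hI.false_of_normal_mem hC hn hD hne hb hycl hij (hyL i i.2) (hyL j j.2) hkI hki hkj
          (p := D k 1 * D j 2 / e) (q := -(D k 1 * D i 2) / e) ?_ ?_ ?_ ?_
        · exact div_nonneg (mul_nonneg dk1 dj2) hgt.le
        · exact div_nonneg (neg_nonneg.2 (mul_nonpos_of_nonneg_of_nonpos dk1 di2)) hgt.le
        · field_simp; rw [he]; ring
        · rw [dk2]; field_simp; ring

end Uniform

/-! ### Boundary behaviour of the logarithmic field -/

theorem exists_pos_add_mul_pos {X : ℝ} (hX : 0 < X) (Y : ℝ) : ∃ ε : ℝ, 0 < ε ∧ 0 < X + ε * Y := by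
  refine ⟨X / (2 * (|Y| + 1)), by positivity, ?_⟩
  have h1 : X / (2 * (|Y| + 1)) * |Y| ≤ X / 2 := by
    rw [div_mul_eq_mul_div, div_le_div_iff₀ (by positivity) (by norm_num)]
    nlinarith [abs_nonneg Y]
  have h2 : -(X / (2 * (|Y| + 1)) * |Y|) ≤ X / (2 * (|Y| + 1)) * Y := by
    rw [← mul_neg]
    exact mul_le_mul_of_nonneg_left (neg_abs_le Y) (by positivity)
  linarith

/-- Two planar vectors `b`, `c` whose first coordinates are nonnegative and not both zero, and two
independent vectors `p`, `q` with compatible signs: some vector in the cone of `p` and `q` has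
positive scalar product with `b` and `c`. -/
theorem exists_mem_cone_pos_of_nonneg {b₁ b₂ c₁ c₂ p₁ p₂ q₁ q₂ : ℝ} (hb₁ : 0 ≤ b₁) (hc₁ : 0 ≤ c₁)
    (hbc : 0 < b₁ ∨ 0 < c₁) (hdet : p₁ * q₂ - p₂ * q₁ ≠ 0)
    (hp₁ : 0 ≤ b₁ * p₁) (hp₂ : 0 ≤ b₂ * p₂) (hp : 0 < b₁ * p₁ ∨ 0 < b₂ * p₂)
    (hp₁0 : b₁ = 0 → p₁ = 0) (hp₂0 : b₂ = 0 → p₂ = 0)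
    (hq₁ : 0 ≤ c₁ * q₁) (hq₂ : 0 ≤ c₂ * q₂) (hq : 0 < c₁ * q₁ ∨ 0 < c₂ * q₂)
    (hq₁0 : c₁ = 0 → q₁ = 0) (hq₂0 : c₂ = 0 → q₂ = 0) :
    ∃ s t : ℝ, 0 ≤ s ∧ 0 ≤ t ∧ 0 < (s * p₁ + t * q₁) * b₁ + (s * p₂ + t * q₂) * b₂ ∧
      0 < (s * p₁ + t * q₁) * c₁ + (s * p₂ + t * q₂) * c₂ := by
  have hsign : ∀ {x y : ℝ}, 0 ≤ x → 0 ≤ x * y → (x = 0 → y = 0) → 0 ≤ y := fun {x y} hx hxy h => by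
    rcases hx.eq_or_lt with h0 | h0
    · exact (h h0.symm).ge
    · exact nonneg_of_mul_nonneg_right hxy h0
  have hsign' : ∀ {x y : ℝ}, x ≤ 0 → 0 ≤ x * y → (x = 0 → y = 0) → y ≤ 0 := fun {x y} hx hxy h => by
    have := hsign (x := -x) (y := -y) (by linarith) (by linarith) (fun h' => by
      rw [h (by linarith), neg_zero])
    linarith
  have p₁n := hsign hb₁ hp₁ hp₁0
  have q₁n := hsign hc₁ hq₁ hq₁0
  have hpb : 0 < p₁ * b₁ + p₂ * b₂ := by rcases hp with hp | hp <;> linarith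
  have hqc : 0 < q₁ * c₁ + q₂ * c₂ := by rcases hq with hq | hq <;> linarith
  have hsame : 0 ≤ q₂ * b₂ → 0 ≤ p₂ * c₂ → ∃ s t : ℝ, 0 ≤ s ∧ 0 ≤ t ∧
      0 < (s * p₁ + t * q₁) * b₁ + (s * p₂ + t * q₂) * b₂ ∧
      0 < (s * p₁ + t * q₁) * c₁ + (s * p₂ + t * q₂) * c₂ := fun h h' =>
    ⟨1, 1, zero_le_one, zero_le_one, by nlinarith [mul_nonneg q₁n hb₁],
      by nlinarith [mul_nonneg p₁n hc₁]⟩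
  -- A cone vector on the positive first axis works when both `b₁` and `c₁` are positive; if one of
  -- them is 0, a small multiple of `p` or `q` repairs that product.
  have hopp : ∀ s t : ℝ, 0 ≤ s → 0 ≤ t → s * p₂ + t * q₂ = 0 → 0 < s * p₁ + t * q₁ →
      ∃ s t : ℝ, 0 ≤ s ∧ 0 ≤ t ∧
      0 < (s * p₁ + t * q₁) * b₁ + (s * p₂ + t * q₂) * b₂ ∧
      0 < (s * p₁ + t * q₁) * c₁ + (s * p₂ + t * q₂) * c₂ := by
    intro s t hs ht h0 hpos
    rcases hb₁.eq_or_lt with hb | hb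
    · have hc : 0 < c₁ := hbc.resolve_left (by linarith)
      obtain ⟨ε, hε, h⟩ := exists_pos_add_mul_pos (mul_pos hpos hc) (p₁ * c₁ + p₂ * c₂)
      refine ⟨s + ε, t, by linarith, ht, ?_, ?_⟩
      · have := mul_pos hε hpb
        have h3 : ((s + ε) * p₁ + t * q₁) * b₁ + ((s + ε) * p₂ + t * q₂) * b₂ =
          ε * (p₁ * b₁ + p₂ * b₂) := by
          linear_combination b₂ * h0 - (s * p₁ + t * q₁) * hb
        rwa [h3]
      · have h3 : ((s + ε) * p₁ + t * q₁) * c₁ + ((s + ε) * p₂ + t * q₂) * c₂ =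
          (s * p₁ + t * q₁) * c₁ + ε * (p₁ * c₁ + p₂ * c₂) := by
          linear_combination c₂ * h0
        rwa [h3]
    · rcases hc₁.eq_or_lt with hc | hc
      · obtain ⟨ε, hε, h⟩ := exists_pos_add_mul_pos (mul_pos hpos hb) (q₁ * b₁ + q₂ * b₂)
        refine ⟨s, t + ε, hs, by linarith, ?_, ?_⟩
        · have h3 : (s * p₁ + (t + ε) * q₁) * b₁ + (s * p₂ + (t + ε) * q₂) * b₂ =
            (s * p₁ + t * q₁) * b₁ + ε * (q₁ * b₁ + q₂ * b₂) := by
            linear_combination b₂ * h0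
          rwa [h3]
        · have := mul_pos hε hqc
          have h3 : (s * p₁ + (t + ε) * q₁) * c₁ + (s * p₂ + (t + ε) * q₂) * c₂ =
            ε * (q₁ * c₁ + q₂ * c₂) := by
            linear_combination c₂ * h0 - (s * p₁ + t * q₁) * hc
          rwa [h3]
      · exact ⟨s, t, hs, ht, by rw [h0]; have := mul_pos hpos hb; linarith,
          by rw [h0]; have := mul_pos hpos hc; linarith⟩
  rcases le_total 0 b₂ with hb₂ | hb₂ <;> rcases le_total 0 c₂ with hc₂ | hc₂
  · exact hsame (mul_nonneg (hsign hc₂ hq₂ hq₂0) hb₂) (mul_nonneg (hsign hb₂ hp₂ hp₂0) hc₂)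
  · have hp₂n := hsign hb₂ hp₂ hp₂0
    have hq₂n := hsign' hc₂ hq₂ hq₂0
    -- These weights cancel the second coordinate and leave minus the determinant in the first.
    refine hopp (-q₂) p₂ (by linarith) hp₂n (by ring) (lt_of_le_of_ne ?_ fun h => hdet ?_)
    · nlinarith [mul_nonneg p₁n (neg_nonneg.2 hq₂n), mul_nonneg hp₂n q₁n]
    · linarith
  · have hp₂n := hsign' hb₂ hp₂ hp₂0
    have hq₂n := hsign hc₂ hq₂ hq₂0
    refine hopp q₂ (-p₂) hq₂n (by linarith) (by ring) (lt_of_le_of_ne ?_ fun h => hdet ?_)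
    · nlinarith [mul_nonneg p₁n hq₂n, mul_nonneg (neg_nonneg.2 hp₂n) q₁n]
    · linarith
  · exact hsame (mul_nonneg_of_nonpos_of_nonpos (hsign' hc₂ hq₂ hq₂0) hb₂)
      (mul_nonneg_of_nonpos_of_nonpos (hsign' hb₂ hp₂ hp₂0) hc₂)

/-- Variant of `exists_mem_cone_pos_of_nonneg` in which the first coordinates of `b` and `c` are
not both zero and not of opposite strict signs. -/
theorem exists_mem_cone_pos {b₁ b₂ c₁ c₂ p₁ p₂ q₁ q₂ : ℝ} (hbc0 : ¬ (b₁ = 0 ∧ c₁ = 0))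
    (hbc : ¬ (0 < b₁ ∧ c₁ < 0)) (hbc' : ¬ (b₁ < 0 ∧ 0 < c₁)) (hdet : p₁ * q₂ - p₂ * q₁ ≠ 0)
    (hp₁ : 0 ≤ b₁ * p₁) (hp₂ : 0 ≤ b₂ * p₂) (hp : 0 < b₁ * p₁ ∨ 0 < b₂ * p₂)
    (hp₁0 : b₁ = 0 → p₁ = 0) (hp₂0 : b₂ = 0 → p₂ = 0)
    (hq₁ : 0 ≤ c₁ * q₁) (hq₂ : 0 ≤ c₂ * q₂) (hq : 0 < c₁ * q₁ ∨ 0 < c₂ * q₂)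
    (hq₁0 : c₁ = 0 → q₁ = 0) (hq₂0 : c₂ = 0 → q₂ = 0) :
    ∃ s t : ℝ, 0 ≤ s ∧ 0 ≤ t ∧ 0 < (s * p₁ + t * q₁) * b₁ + (s * p₂ + t * q₂) * b₂ ∧
      0 < (s * p₁ + t * q₁) * c₁ + (s * p₂ + t * q₂) * c₂ := by
  by_cases h : 0 ≤ b₁ ∧ 0 ≤ c₁
  · refine exists_mem_cone_pos_of_nonneg h.1 h.2 ?_ hdet hp₁ hp₂ hp hp₁0 hp₂0 hq₁ hq₂ hq hq₁0 hq₂0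
    by_contra! h'
    exact hbc0 ⟨le_antisymm h'.1 h.1, le_antisymm h'.2 h.2⟩
  · have hneg : b₁ ≤ 0 ∧ c₁ ≤ 0 := by
      by_contra! h'
      grind
    obtain ⟨s, t, hs, ht, h1, h2⟩ := exists_mem_cone_pos_of_nonneg (b₁ := -b₁) (c₁ := -c₁)
      (p₁ := -p₁) (q₁ := -q₁) (p₂ := p₂) (q₂ := q₂) (b₂ := b₂) (c₂ := c₂)
      (by linarith) (by linarith) (by grind)
      (fun h => hdet (by linarith)) (by linarith) hp₂ (by simpa using hp)
      (fun h => by rw [hp₁0 (by linarith), neg_zero]) hp₂0 (by linarith) hq₂ (by simpa using hq)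
      (fun h => by rw [hq₁0 (by linarith), neg_zero]) hq₂0
    exact ⟨s, t, hs, ht, by linarith, by linarith⟩

/-- A weighted sum of `-log` of functions that are positive near a point diverges, if the weights
of the functions vanishing there are positive. -/
theorem eventually_pos_sum_neg_log {n : ℕ} {X : Type*} [TopologicalSpace X] {U : Set X} {v : X}
    {g : Fin n → X → ℝ} (hg : ∀ i, Continuous (g i)) (hU : ∀ w ∈ U, ∀ i, 0 < g i w)
    {κ : Fin n → ℝ} (hκ : ∀ i, g i v = 0 → 0 < κ i) {i₀ : Fin n} (hi₀ : g i₀ v = 0) :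
    ∀ᶠ w in nhdsWithin v U, 0 < ∑ i, κ i * -Real.log (g i w) := by
  classical
  have hvan : ∀ i, g i v = 0 →
      Filter.Tendsto (fun w => κ i * -Real.log (g i w)) (nhdsWithin v U) Filter.atTop := by
    intro i hi
    refine Filter.Tendsto.const_mul_atTop (hκ i hi) (Filter.tendsto_neg_atBot_atTop.comp
      (Real.tendsto_log_nhdsGT_zero.comp (tendsto_nhdsWithin_iff.2 ⟨?_, ?_⟩)))
    · exact hi ▸ ((hg i).tendsto v).mono_left nhdsWithin_le_nhds
    · filter_upwards [self_mem_nhdsWithin] with w hw using hU w hw i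
  set Z : Finset (Fin n) := Finset.univ.filter fun i => g i v = 0 with hZ
  have hZtop : Filter.Tendsto (fun w => ∑ i ∈ Z, κ i * -Real.log (g i w)) (nhdsWithin v U)
      Filter.atTop := by
    refine Filter.tendsto_atTop_mono' _ ?_ (hvan i₀ hi₀)
    have hall : ∀ᶠ w in nhdsWithin v U, ∀ i ∈ Z, 0 ≤ κ i * -Real.log (g i w) := by
      rw [Filter.eventually_all_finset]
      exact fun i hi => (hvan i (Finset.mem_filter.1 hi).2).eventually_ge_atTop 0
    filter_upwards [hall] with w hw
    exact Finset.single_le_sum (f := fun i => κ i * -Real.log (g i w)) hw (by simp [hZ, hi₀])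
  have hZc : Filter.Tendsto (fun w => ∑ i ∈ Zᶜ, κ i * -Real.log (g i w)) (nhdsWithin v U)
      (nhds (∑ i ∈ Zᶜ, κ i * -Real.log (g i v))) := by
    refine tendsto_finsetSum _ fun i hi => ?_
    have hi' : g i v ≠ 0 := by simpa [hZ] using hi
    exact ((((hg i).tendsto v).log hi').neg.const_mul _).mono_left nhdsWithin_le_nhds
  filter_upwards [(hZtop.atTop_add hZc).eventually_gt_atTop 0] with w hw
  rwa [Finset.sum_add_sum_compl] at hw

/-! ### From the dual system to the polynomial system -/

/-- Gale duality: a point of `Δ_P` solving the dual system yields a positive solution. -/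
theorem positiveSolutions_nonempty {d n m k : ℕ} {a : Fin n → Fin d → ℝ}
    {C : Matrix (Fin d) (Fin n) ℝ} {B : Matrix (Fin n) (Fin m) ℝ} {D : Matrix (Fin n) (Fin k) ℝ}
    (hB : IsGaleDual (pointMatrix a) B) (hD : IsGaleDual C D) {y : Fin k → ℝ}
    (hy : ∀ i, 0 < D.row i ⬝ᵥ y) (h : ∀ j, ∑ i, B i j * Real.log (D.row i ⬝ᵥ y) = 0) :
    (positiveSolutions a C).Nonempty := by
  set ℓ : Fin n → ℝ := fun i => Real.log (D.row i ⬝ᵥ y) with hℓ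
  let K : (Fin n → ℝ) →ₗ[ℝ] ℝ := Fintype.linearCombination ℝ ℓ
  let L : Fin (d + 1) → (Fin n → ℝ) →ₗ[ℝ] ℝ := fun r =>
    LinearMap.proj r ∘ₗ (pointMatrix a).mulVecLin
  -- The vector of logarithms is orthogonal to `ker A`, hence lies in the row space of `A`.
  have hmem : K ∈ Submodule.span ℝ (Set.range L) := by
    refine mem_span_of_iInf_ker_le_ker fun x hx => ?_
    have hx' : x ∈ LinearMap.ker (pointMatrix a).mulVecLin := by
      rw [LinearMap.mem_ker]
      ext r
      have := (Submodule.mem_iInf _).1 hx r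
      simpa [L] using this
    rw [← (isGaleDual_iff.1 hB).2] at hx'
    obtain ⟨z, rfl⟩ := hx'
    rw [LinearMap.mem_ker]
    simp only [K, Fintype.linearCombination_apply, Matrix.mulVecLin_apply, Matrix.mulVec,
      dotProduct, smul_eq_mul, Finset.sum_mul]
    rw [Finset.sum_comm]
    refine Finset.sum_eq_zero fun j _ => ?_
    have := congrArg (z j * ·) (h j)
    simp only [Finset.mul_sum, mul_zero] at this
    rw [← this]
    exact Finset.sum_congr rfl fun i _ => by ring
  obtain ⟨c, hc⟩ := (Submodule.mem_span_range_iff_exists_fun ℝ).1 hmem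
  have hlog : ∀ i, ℓ i = c 0 + ∑ q, c q.succ * a i q := fun i => by
    have := LinearMap.congr_fun hc (Pi.single i 1)
    simp [K, L, pointMatrix, Fin.sum_univ_succ] at this
    simpa [Fintype.linearCombination_apply_single] using this.symm
  -- The constant `c 0` only rescales all monomials, which the homogeneous linear system ignores.
  have hmon : ∀ i, monomial (fun q => Real.exp (c q.succ)) (a i) =
      Real.exp (-c 0) * (D.row i ⬝ᵥ y) := fun i => by
    have h1 : D.row i ⬝ᵥ y = Real.exp (ℓ i) := (Real.exp_log (hy i)).symm
    rw [h1, hlog, ← Real.exp_add, neg_add_cancel_left, Real.exp_sum, monomial]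
    exact Finset.prod_congr rfl fun q _ => by rw [← Real.exp_mul]
  refine ⟨fun q => Real.exp (c q.succ), fun q => Real.exp_pos _, fun i => ?_⟩
  have h1 := congrFun (hD.mulVec_mulVec y) i
  have h2 := congrArg (Real.exp (-c 0) * ·) h1
  simp only [Pi.zero_apply, mul_zero] at h2
  rw [← h2]
  simp only [hmon]
  simp only [Matrix.mulVec, dotProduct, Finset.mul_sum, Matrix.row]
  refine Finset.sum_congr rfl fun j _ => Finset.sum_congr rfl fun _ _ => ?_
  ring

section Uniform

variable {d n : ℕ} {C : Matrix (Fin d) (Fin n) ℝ} {D : Matrix (Fin n) (Fin (2 + 1)) ℝ}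
  {I : Set (Fin n)}

/-- At a boundary point `y` of `Δ_P`, some inner normal direction `u` has positive scalar product
with all the rows of `B` that correspond to the edges through `y`. -/
theorem exists_normal_pos (hC : Uniform C) (hn : n = d + (2 + 1))
    (hD : IsGaleDual C D) (hne : (delta D).Nonempty) (hb : Bornology.IsBounded (delta D))
    (hI : IsMinimalGenerating D I) {B : Matrix (Fin n) (Fin 2) ℝ}
    (h1 : ConditionOne B D I) (h2 : ConditionTwo B D I) {c : Fin (2 + 1) → ℝ} (hc : c ∈ delta D)
    {y : Fin (2 + 1) → ℝ} (hy : y ∈ closure (delta D)) {i : Fin n} (hi : D.row i ⬝ᵥ y = 0) :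
    ∃ u₁ u₂ : ℝ, u₁ * (y 1 - c 1) + u₂ * (y 2 - c 2) < 0 ∧
      ∀ m, D.row m ⬝ᵥ y = 0 → 0 < u₁ * B m 0 + u₂ * B m 1 := by
  have hmemI : ∀ m, D.row m ⬝ᵥ y = 0 → m ∈ I := fun m hm =>
    (hI.mem_iff hC hn hD hne hb).2 ⟨y, hy, hm⟩
  have hy0 : y 0 = 1 := by
    have := hy
    rw [closure_delta hne] at this
    exact this.2
  have hinner : ∀ m, D.row m ⬝ᵥ y = 0 → D m 1 * (y 1 - c 1) + D m 2 * (y 2 - c 2) < 0 := by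
    intro m hm
    have hcm := hc.1 m
    rw [row_dotProduct_three] at hm hcm
    rw [hy0] at hm
    rw [hc.2] at hcm
    linarith
  have hcond : ∀ m ∈ I, (0 ≤ B m 0 * D m 1 ∧ 0 ≤ B m 1 * D m 2) ∧
      (0 < B m 0 * D m 1 ∨ 0 < B m 1 * D m 2) ∧ (B m 0 = 0 → D m 1 = 0) ∧
      (B m 1 = 0 → D m 2 = 0) := fun m hm => by
    have := h2 m hm
    simp only [Fin.forall_fin_two, Fin.exists_fin_two] at this
    exact this
  by_cases hj : ∃ j, j ≠ i ∧ D.row j ⬝ᵥ y = 0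
  · obtain ⟨j, hji, hj⟩ := hj
    have hdet := hD.det_ne_zero_of_vertex hC hn hy0 hji.symm hi hj
    obtain ⟨ci, ci', ci1, ci2⟩ := hcond i (hmemI i hi)
    obtain ⟨cj, cj', cj1, cj2⟩ := hcond j (hmemI j hj)
    obtain ⟨s, t, hs, ht, hbi, hbj⟩ : ∃ s t : ℝ, 0 ≤ s ∧ 0 ≤ t ∧
        0 < (s * D i 1 + t * D j 1) * B i 0 + (s * D i 2 + t * D j 2) * B i 1 ∧
        0 < (s * D i 1 + t * D j 1) * B j 0 + (s * D i 2 + t * D j 2) * B j 1 := by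
      have hmix := h1 {i, j} ⟨?_, ⟨i, by simp⟩, y, hy, ?_⟩
      · simp only [WeaklyMixed, Matrix.submatrix_apply, id, Subtype.forall, Subtype.exists,
          Set.mem_insert_iff, Set.mem_singleton_iff, forall_eq_or_imp, forall_eq, exists_prop,
          exists_eq_or_imp, exists_eq_left, Fin.forall_fin_two, not_and_or] at hmix
        -- Either column of `B` may be the unmixed one; the second case exchanges the two
        -- coordinates.
        rcases hmix with hmix | hmix
        · exact exists_mem_cone_pos (by grind) (by grind) (by grind) hdet ci.1 ci.2 ci' ci1 ci2
            cj.1 cj.2 cj' cj1 cj2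
        · obtain ⟨s, t, hs, ht, e1, e2⟩ := exists_mem_cone_pos (b₁ := B i 1) (b₂ := B i 0)
            (c₁ := B j 1) (c₂ := B j 0) (by grind) (by grind) (by grind)
            (fun h => hdet (by linarith)) ci.2 ci.1 ci'.symm ci2 ci1 cj.2 cj.1 cj'.symm cj2 cj1
          exact ⟨s, t, hs, ht, by linarith, by linarith⟩
      · rintro m (rfl | rfl)
        exacts [hmemI _ hi, hmemI _ hj]
      · rintro m (rfl | rfl)
        exacts [hi, hj]
    refine ⟨s * D i 1 + t * D j 1, s * D i 2 + t * D j 2, ?_, fun m hm => ?_⟩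
    · have hst : 0 < s ∨ 0 < t := by
        by_contra! h
        rw [le_antisymm h.1 hs, le_antisymm h.2 ht] at hbi
        simp at hbi
      have e1 := hinner i hi
      have e2 := hinner j hj
      rcases hst with h | h
      · nlinarith [mul_neg_of_pos_of_neg h e1, mul_nonpos_of_nonneg_of_nonpos ht e2.le]
      · nlinarith [mul_neg_of_pos_of_neg h e2, mul_nonpos_of_nonneg_of_nonpos hs e1.le]
    · rcases hD.eq_or_eq_of_dotProduct_eq_zero hC hn hy0 hji.symm hi hj hm with rfl | rfl
      exacts [hbi, hbj]
  · push Not at hj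
    -- On a single edge its own inner normal suffices, by condition (2).
    refine ⟨D i 1, D i 2, hinner i hi, fun m hm => ?_⟩
    obtain rfl : m = i := by
      by_contra h
      exact hj m h hm
    have := hcond m (hmemI m hm)
    rcases this.2.1 with h | h <;> linarith [this.1.1, this.1.2]

/-- The dual system has a solution in `Δ_P` as soon as both conditions hold. -/
theorem exists_dual_solution (hC : Uniform C) (hn : n = d + (2 + 1))
    (hD : IsGaleDual C D) (hne : (delta D).Nonempty) (hb : Bornology.IsBounded (delta D))
    (hI : IsMinimalGenerating D I) {B : Matrix (Fin n) (Fin 2) ℝ}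
    (h1 : ConditionOne B D I) (h2 : ConditionTwo B D I) :
    ∃ y ∈ delta D, ∀ j, ∑ i, B i j * Real.log (D.row i ⬝ᵥ y) = 0 := by
  obtain ⟨c, hc⟩ := id hne
  -- Chart of the plane `y 0 = 1` with the interior point `c` as origin.
  let Y : ℂ → Fin (2 + 1) → ℝ := fun w => ![1, c 1 + w.re, c 2 + w.im]
  have hYc : Continuous Y := by
    refine continuous_pi fun q => ?_
    fin_cases q
    · exact continuous_const
    · exact continuous_const.add Complex.continuous_re
    · exact continuous_const.add Complex.continuous_im
  have hℓ : ∀ i, Continuous fun w => D.row i ⬝ᵥ Y w := fun i => continuous_const.dotProduct hYc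
  set U : Set ℂ := {w | ∀ i, 0 < D.row i ⬝ᵥ Y w} with hU
  have hUdelta : ∀ w ∈ U, Y w ∈ delta D := fun w hw => ⟨hw, rfl⟩
  have hUo : IsOpen U := by
    rw [hU, Set.ofPred_forall]
    exact isOpen_iInter_of_finite fun i => isOpen_lt continuous_const (hℓ i)
  have h0U : (0 : ℂ) ∈ U := by
    have : Y 0 = c := by
      ext q
      fin_cases q
      · exact hc.2.symm
      · simp [Y]
      · simp [Y]
    intro i
    rw [this]
    exact hc.1 i
  have hUb : Bornology.IsBounded U := by
    obtain ⟨R, hR⟩ := hb.exists_norm_le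
    refine isBounded_iff_forall_norm_le.2 ⟨(R + ‖c‖) + (R + ‖c‖), fun w hw => ?_⟩
    have h3 := hR _ (hUdelta w hw)
    have hre : |w.re| ≤ R + ‖c‖ := by
      have e1 := (norm_le_pi_norm (Y w) 1).trans h3
      have e2 := norm_le_pi_norm c 1
      have e3 : w.re = Y w 1 - c 1 := by simp [Y]
      rw [e3]
      exact (norm_sub_le _ _).trans (add_le_add e1 e2)
    have him : |w.im| ≤ R + ‖c‖ := by
      have e1 := (norm_le_pi_norm (Y w) 2).trans h3
      have e2 := norm_le_pi_norm c 2
      have e3 : w.im = Y w 2 - c 2 := by simp [Y]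
      rw [e3]
      exact (norm_sub_le _ _).trans (add_le_add e1 e2)
    exact (Complex.norm_le_abs_re_add_abs_im w).trans (add_le_add hre him)
  let F : Fin 2 → ℂ → ℝ := fun j w => ∑ i, B i j * -Real.log (D.row i ⬝ᵥ Y w)
  have hF : ∀ j, ContinuousOn (F j) U := fun j =>
    continuousOn_finsetSum _ fun i _ =>
      (((hℓ i).continuousOn.log fun w hw => (hw i).ne').neg.const_mul _)
  obtain ⟨w, hw, hfw⟩ := Complex.exists_eq_zero_of_frontier hUo hUb h0U
    (f := fun w => (F 0 w : ℂ) + F 1 w * Complex.I)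
    ((Complex.continuous_ofReal.comp_continuousOn (hF 0)).add
      ((Complex.continuous_ofReal.comp_continuousOn (hF 1)).mul continuousOn_const)) (by
    intro v hv
    rw [hUo.frontier_eq] at hv
    have hYv : Y v ∈ closure (delta D) :=
      map_mem_closure hYc hv.1 hUdelta
    have hYv' := hYv
    rw [closure_delta hne] at hYv'
    obtain ⟨i, hi⟩ : ∃ i, D.row i ⬝ᵥ Y v = 0 := by
      by_contra! h
      exact hv.2 fun i => lt_of_le_of_ne (hYv'.1 i) (h i).symm
    obtain ⟨u₁, u₂, hu, hpos⟩ := exists_normal_pos hC hn hD hne hb hI h1 h2 hc hYv hi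
    refine ⟨⟨u₁, u₂⟩, ?_, ?_⟩
    · have e1 : Y v 1 - c 1 = v.re := by simp [Y]
      have e2 : Y v 2 - c 2 = v.im := by simp [Y]
      rw [e1, e2] at hu
      rw [Complex.inner]
      simp
      linarith
    · have hev := eventually_pos_sum_neg_log (U := U) (v := v) hℓ (fun w hw i => hw i)
        (κ := fun m => u₁ * B m 0 + u₂ * B m 1) hpos hi
      filter_upwards [hev] with w hw
      have e1 : ∑ m, (u₁ * B m 0 + u₂ * B m 1) * -Real.log (D.row m ⬝ᵥ Y w) =
          u₁ * F 0 w + u₂ * F 1 w := by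
        simp only [F, Finset.mul_sum, ← Finset.sum_add_distrib]
        exact Finset.sum_congr rfl fun m _ => by ring
      rw [e1] at hw
      rw [Complex.inner]
      simp
      linarith)
  have hF0 : ∀ j, F j w = 0 := by
    have hre := congrArg Complex.re hfw
    have him := congrArg Complex.im hfw
    simp at hre him
    exact Fin.forall_fin_two.2 ⟨hre, him⟩
  refine ⟨Y w, hUdelta w hw, fun j => ?_⟩
  have := hF0 j
  simp only [F, mul_neg, Finset.sum_neg_distrib, neg_eq_zero] at this
  exact this

end Uniform

end GaleDuality


theorem lemma5p8 {d n : ℕ} (hn : n = d + 1 + 2) (a : Fin n → Fin d → ℝ)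
    (ha : Function.Injective a) (C : Matrix (Fin d) (Fin n) ℝ)
    (hA : GaleDuality.Uniform (GaleDuality.pointMatrix a)) (hC : GaleDuality.Uniform C)
    (h0 : (0 : Fin d → ℝ) ∈ GaleDuality.openColumnCone C) :
    ∃ B : Matrix (Fin n) (Fin 2) ℝ, GaleDuality.IsGaleDual (GaleDuality.pointMatrix a) B ∧
      ∀ D : Matrix (Fin n) (Fin (2 + 1)) ℝ, GaleDuality.IsGaleDual C D →
        (GaleDuality.delta D).Nonempty → Bornology.IsBounded (GaleDuality.delta D) →
          ∀ I : Set (Fin n), GaleDuality.IsMinimalGenerating D I →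
            GaleDuality.ConditionTwo B D I →
              GaleDuality.ConditionOne B D I ∧ 0 < GaleDuality.numPositiveSolutions a C := by
  open GaleDuality in
  have hn' : n = d + (2 + 1) := by omega
  -- `B` must precede `D`, so `I` is read off from any admissible `D₀`; without one, every Gale dual
  -- `B` works vacuously.
  by_cases hex : ∃ (D : Matrix (Fin n) (Fin (2 + 1)) ℝ) (I : Set (Fin n)), IsGaleDual C D ∧
      (delta D).Nonempty ∧ Bornology.IsBounded (delta D) ∧ IsMinimalGenerating D I
  · obtain ⟨D₀, I₀, hD₀, hne₀, hb₀, hI₀⟩ := hex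
    obtain ⟨B, hB, hk, hl, hW⟩ := hA.exists_normalized_isGaleDual hn
      (hI₀.nontrivial hC hn' hD₀)
    refine ⟨B, hB, fun D hD hne hb I hI h2 => ?_⟩
    have hII : I = I₀ := by
      ext k
      rw [hI.mem_iff hC hn' hD hne hb, (hD₀.isMinimalGenerating hD hI₀).mem_iff hC hn' hD hne hb]
    subst hII
    have h1 := conditionOne_of_normalized hA hn hC hn' hD hne hb hI hB hk hl hW h2
    obtain ⟨y, hy, hy'⟩ := exists_dual_solution hC hn' hD hne hb hI h1 h2
    exact ⟨h1, Set.encard_pos.2 (positiveSolutions_nonempty hB hD hy.1 hy')⟩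
  · obtain ⟨B, hB⟩ := hA.exists_isGaleDual (m := 2) hn
    exact ⟨B, hB, fun D hD hne hb I hI _ => (hex ⟨D, I, hD, hne, hb, hI⟩).elim⟩
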